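/- **Setting.** Let $[\underline y,\bar y]$ be a compact choice interval with a cutoff $k$ in its interior, $\mathcal X\subseteq\mathbb R^{d_x}$, $\mathcal H\subseteq\mathbb R$, $\Theta\subseteq\mathbb R^{d_\theta}$, $\theta_0\in\Theta$. A unit has covariates $X\in\mathcal X$ and unobserved heterogeneity $\eta\in\mathcal H$. For $\theta\in\Theta$ and $d\in\{0,1\}$ the value $m(d,x,\eta,\theta)$ maximizes a payoff $y\mapsto U_d(y,x,\eta,\theta)$ over $[\underline y,\bar y]$. Write $Y^*(d)=m(d,X,\eta,\theta_0)$; the desired choice $Y^*$ maximizes $U_0\mathbf 1\{y\le k\}+U_1\mathbf 1\{y>k\}$ at $\theta=\theta_0$; $Y$ is the observed choice. **Assumption 1.** Each $U_d$ is strictly concave in $y$, and $U_0-U_1$ is $\le 0$ for $y<k$, $=0$ at $y=k$, and $\ge 0$ for $y>k$. **Assumption 2.** For all $d,x,\theta$, $m(d,x,\cdot,\theta)$ is strictly increasing on $\mathcal H$ with inverse $m^{-1}(d,x,\cdot,\theta)$; both $m(d,x,\eta,\theta)$ in $(x,\eta)$ and $m^{-1}(d,x,y,\theta)$ in $(x,y)$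 are continuous. The reversion $R(y,x,\theta)=m(0,x,m^{-1}(1,x,y,\theta),\theta)$ is defined at $y=k_1$ for all $x\in\mathcal X$, $\theta\in\Theta$. **Assumption 3.** $k\in[k_0,k_1]\subseteq[\underline y,\bar y]$; if $Y^*=k$ then $Y\in[k_0,k_1]$; and $Y=Y^*$ whenever $Y\notin[k_0,k_1]$ or $Y^*\notin[k_0,k_1]$ (almost surely). For each $d$, $Y^*(d)$ has on an interval $\mathcal Y_d=[\underline{\mathcal Y}_d,\bar{\mathcal Y}_d]$ containing $k_d$ in its interior a density $f_{Y^*(d)}$ bounded above and bounded away from $0$. **Analyticity condition.** Functions $f$ and $(g_\tau)_{\tau\in(0,1)}$ on $[a,b]$ satisfy it for $(\rho,\beta,\delta)$ if each extends analytically to an $R$-neighbourhood of $[a,b]$ in $\mathbb C$ for some $R>\rho$ and (i) $\int_a^b\int_0^1|f(y+\rho e^{2\pi ix})|\,dx\,dy\le\beta\int_a^b|f(y)|\,dy$; (ii) $\sup_{x\in[0,1]}|g_\tau(y+\rho e^{2\pi ix})-y|\,\mathbf 1\{g_\tau(y)\ge y\}\le\delta\rho$ for all $y\in[a,b]$, $\tau\in(0,1)$;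 (iii) $\sup_{y,\tau,x}|g_\tau(y+\rho e^{2\pi ix})|<\infty$. **Assumption 4.** $T=t(X)\ge0$ is bounded and $\inf_{y\in\mathcal Y_0}E[T\mid Y^*(0)=y]>0$. Let $P_T(A)=E[\mathbf 1_AT]/E[T]$, let $f^{(P_T)}(y)=f_{Y^*(0)}(y)E[T\mid Y^*(0)=y]/E[T]$ be the density of $Y^*(0)$ under $P_T$, and let $g^{(P_T)}(\tau,\theta,y)$ be the $\tau$-quantile of $R(k_1,X,\theta)$ given $Y^*(0)=y$ under $P_T$. For each $\theta\in\Theta$ let $\bar k_1(\theta)\in[k,\bar{\mathcal Y}_0]$, $\bar k_1(\theta)>k_0$, satisfy $$P_T\big(R(k_1,X,\theta)>\bar k_1(\theta),\ k_0\le Y^*(0)\le R(k_1,X,\theta)\big)=0 .$$ There are $\rho>0$, $\beta\ge0$, $\delta\in[0,1)$ such that for every $\theta\in\Theta$, $f^{(P_T)}$ and $(g^{(P_T)}(\tau,\theta,\cdot))_{\tau\in(0,1)}$ satisfy the analyticity condition on $[k_0,\bar k_1(\theta)]$ for $(\rho,\beta,\delta)$. The map $\theta\mapsto E[T\,\mathbf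 1\{k_0\le Y^*(0)\le R(k_1,X,\theta)\}]$ is one-to-one on $\Theta$. (Conditional expectations and quantiles given $Y^*(0)=y$ are computed from one regular conditional distribution of $X$ given $Y^*(0)$.) **Theorem.** Under Assumptions 1–4, for every $\theta\in\Theta$ the functions $y\mapsto E[T(R(k_1,X,\theta)-k_0)^j\mid Y^*(0)=y]f_{Y^*(0)}(y)$, $j\ge1$, are $C^\infty$ on $[k_0,\bar k_1(\theta)]$, and the series $$B(\theta)=\sum_{j=1}^\infty\frac1{j!}D_y^{j-1}\Big[E[T(R(k_1,X,\theta)-k_0)^j\mid Y^*(0)=y]\,f_{Y^*(0)}(y)\Big]_{y=k_0}$$ (derivatives at the left endpoint $k_0$ being taken from the right) converges absolutely and is nonnegative. The parameter $\theta_0$ is the unique $\theta\in\Theta$ with $B(\theta)=E[T\,\mathbf 1\{Y\in[k_0,k_1]\}]$. Moreover, for every $\theta\in\Theta$ for which $\beta$ bounds the relative variation of the density pointwise, i.e. $\int_0^1|f^{(P_T)}(y+\rho e^{2\pi ix})|\,dx\le\beta f^{(P_T)}(y)$ for all $y\in[k_0,\bar k_1(\theta)]$, and for every integer $l\ge0$,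 $$\Big|\sum_{j=l+1}^\infty\frac1{j!}D_y^{j-1}\Big[E[T(R(k_1,X,\theta)-k_0)^j\mid Y^*(0)=y]\,f_{Y^*(0)}(y)\Big]_{y=k_0}\Big|\le\beta\,\delta^l B(\theta).$$ -/

import Mathlib

open MeasureTheory ProbabilityTheory Set

noncomputable section

/-- The measure with density proportional to the weight `w`, i.e.
`A ↦ E_μ[1_A w] / E_μ[w]`. -/
def weighted {α : Type*} [MeasurableSpace α] (μ : Measure α) (w : α → ℝ) : Measure α :=
  (ENNReal.ofReal (∫ a, w a ∂μ))⁻¹ • μ.withDensity (fun a => ENNReal.ofReal (w a))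

/-- The `τ`-quantile of the real random variable `W` under the probability measure `ν`. -/
def quantile {α : Type*} [MeasurableSpace α] (ν : Measure α) (W : α → ℝ) (τ : ℝ) : ℝ :=
  sInf {w : ℝ | τ ≤ ν.real {x | W x ≤ w}}

/-- `H` is the analytic continuation of `h : [a, b] → ℝ` to an `R`-neighbourhood of `[a, b]` in
the complex plane, for some `R > ρ`. -/
def IsAnalyticContinuation (a b ρ : ℝ) (h : ℝ → ℝ) (H : ℂ → ℂ) : Prop :=
  (∃ R : ℝ, ρ < R ∧
    DifferentiableOn ℂ H (Metric.thickening R ((fun y : ℝ => (y : ℂ)) '' Icc a b))) ∧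
  ∀ y ∈ Icc a b, H (y : ℂ) = (h y : ℂ)

/-- The point `y + ρ e^{2πix}` of the complex plane. -/
def circlePoint (y ρ x : ℝ) : ℂ :=
  (y : ℂ) + (ρ : ℂ) * Complex.exp (2 * (Real.pi : ℂ) * Complex.I * (x : ℂ))

/-- The analyticity condition on `[a, b]` for the smoothness constants `(ρ, β, δ)`. -/
def AnalyticityCondition (a b : ℝ) (f : ℝ → ℝ) (g : ℝ → ℝ → ℝ) (ρ β δ : ℝ) : Prop :=
  ∃ (F : ℂ → ℂ) (G : ℝ → ℂ → ℂ),
    IsAnalyticContinuation a b ρ f F ∧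
    (∀ τ ∈ Ioo (0 : ℝ) 1, IsAnalyticContinuation a b ρ (g τ) (G τ)) ∧
    (∫ y in a..b, ∫ x in (0 : ℝ)..1, ‖F (circlePoint y ρ x)‖) ≤ β * ∫ y in a..b, |f y| ∧
    (∀ y ∈ Icc a b, ∀ τ ∈ Ioo (0 : ℝ) 1, ∀ x ∈ Icc (0 : ℝ) 1,
      0 ≤ g τ y - y → ‖G τ (circlePoint y ρ x) - (y : ℂ)‖ ≤ δ * ρ) ∧
    (∃ C : ℝ, ∀ y ∈ Icc a b, ∀ τ ∈ Ioo (0 : ℝ) 1, ∀ x ∈ Icc (0 : ℝ) 1,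
      ‖G τ (circlePoint y ρ x)‖ ≤ C)

/-- `β` bounds the mean of `|f|` over the circle of radius `ρ` around `y`, relative to `|f y|`,
at every point `y` of `[a, b]`. -/
def RelativeVariationLE (a b : ℝ) (f : ℝ → ℝ) (ρ β : ℝ) : Prop :=
  ∃ F : ℂ → ℂ, IsAnalyticContinuation a b ρ f F ∧
    ∀ y ∈ Icc a b, (∫ x in (0 : ℝ)..1, ‖F (circlePoint y ρ x)‖) ≤ β * |f y|

/-- The primitives of a kink bunching design. `Fin 2` indexes the prekink (`0`) and the
postkink (`1`) policy. -/
structure BunchingModel (Ω : Type*) (dx dθ : ℕ) where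
  /-- the range of the covariates -/
  covSet : Set (EuclideanSpace ℝ (Fin dx))
  /-- the range of the unobserved heterogeneity -/
  hetSet : Set ℝ
  /-- the parameter space -/
  paramSet : Set (EuclideanSpace ℝ (Fin dθ))
  /-- the true parameter -/
  θ₀ : EuclideanSpace ℝ (Fin dθ)
  /-- the choice interval is `[yLow, yUp]` -/
  yLow : ℝ
  yUp : ℝ
  /-- the cutoff -/
  k : ℝ
  /-- the window of optimization errors is `[k₀, k₁]` -/
  k₀ : ℝ
  k₁ : ℝ
  /-- the interval on which the counterfactual choice under policy `d` has a positive density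
  is `[lo d, hi d]` -/
  lo : Fin 2 → ℝ
  hi : Fin 2 → ℝ
  /-- the counterfactual payoffs `U d y x η θ` -/
  U : Fin 2 → ℝ → covSet → ℝ → EuclideanSpace ℝ (Fin dθ) → ℝ
  /-- the structural equations `m d x η θ` -/
  m : Fin 2 → covSet → ℝ → EuclideanSpace ℝ (Fin dθ) → ℝ
  /-- the covariates of a unit -/
  X : Ω → covSet
  /-- the heterogeneity of a unit -/
  η : Ω → ℝ
  /-- the desired choice under the actual policy -/
  Ystar : Ω → ℝ
  /-- the observed choice -/
  Y : Ω → ℝ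
  /-- the densities of the counterfactual choices -/
  f : Fin 2 → ℝ → ℝ
  /-- the weight as a function of the covariates -/
  t : covSet → ℝ
  /-- upper ends of the intervals on which analyticity is imposed -/
  kBar : EuclideanSpace ℝ (Fin dθ) → ℝ

namespace BunchingModel

variable {Ω : Type*} {dx dθ : ℕ} (M : BunchingModel Ω dx dθ)

/-- The compound payoff under the actual policy. -/
def compoundPayoff (y : ℝ) (x : M.covSet) (η : ℝ) (θ : EuclideanSpace ℝ (Fin dθ)) : ℝ :=
  if y ≤ M.k then M.U 0 y x η θ else M.U 1 y x η θ

/-- The counterfactual choice `Y*(d)`. -/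
def choice (d : Fin 2) (ω : Ω) : ℝ := M.m d (M.X ω) (M.η ω) M.θ₀

/-- The inverse of `m d x · θ` on the heterogeneity range. -/
def mInv (d : Fin 2) (x : M.covSet) (y : ℝ) (θ : EuclideanSpace ℝ (Fin dθ)) : ℝ :=
  Function.invFunOn (fun η => M.m d x η θ) M.hetSet y

/-- The reversion `R(y, x, θ)`. -/
def reversion (y : ℝ) (x : M.covSet) (θ : EuclideanSpace ℝ (Fin dθ)) : ℝ :=
  M.m 0 x (M.mInv 1 x y θ) θ

/-- The weight `T`. -/
def T (ω : Ω) : ℝ := M.t (M.X ω)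

/-- The environment: the desired choice maximizes the compound payoff; the structural equations
are the maximizers of the counterfactual payoffs. -/
structure Environment [MeasurableSpace Ω] : Prop where
  θ₀_mem : M.θ₀ ∈ M.paramSet
  measurable_X : Measurable M.X
  measurable_η : Measurable M.η
  measurable_Y : Measurable M.Y
  measurable_t : Measurable M.t
  η_mem : ∀ ω, M.η ω ∈ M.hetSet
  k_mem : M.k ∈ Ioo M.yLow M.yUp
  choice_max : ∀ θ ∈ M.paramSet, ∀ d, ∀ x, ∀ η ∈ M.hetSet,
    M.m d x η θ ∈ Icc M.yLow M.yUp ∧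
    IsMaxOn (fun y => M.U d y x η θ) (Icc M.yLow M.yUp) (M.m d x η θ)
  Ystar_max : ∀ ω, M.Ystar ω ∈ Icc M.yLow M.yUp ∧
    IsMaxOn (fun y => M.compoundPayoff y (M.X ω) (M.η ω) M.θ₀) (Icc M.yLow M.yUp) (M.Ystar ω)

/-- Strictly concave payoffs that cross at the cutoff. -/
structure KinkedPayoff : Prop where
  strictConcave : ∀ θ ∈ M.paramSet, ∀ d, ∀ x, ∀ η ∈ M.hetSet,
    StrictConcaveOn ℝ (Icc M.yLow M.yUp) (fun y => M.U d y x η θ)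
  crossing : ∀ θ ∈ M.paramSet, ∀ x, ∀ η ∈ M.hetSet, ∀ y ∈ Icc M.yLow M.yUp,
    (y < M.k → M.U 0 y x η θ - M.U 1 y x η θ ≤ 0) ∧
    (y = M.k → M.U 0 y x η θ - M.U 1 y x η θ = 0) ∧
    (M.k < y → 0 ≤ M.U 0 y x η θ - M.U 1 y x η θ)

/-- Invertible structural equations. The last field says that the reversion is defined at
`k₁`. -/
structure InvertibleStructure : Prop where
  strictMono : ∀ d, ∀ x, ∀ θ ∈ M.paramSet, StrictMonoOn (fun η => M.m d x η θ) M.hetSet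
  continuous_m : ∀ d, ∀ θ ∈ M.paramSet,
    ContinuousOn (fun p : M.covSet × ℝ => M.m d p.1 p.2 θ) {p | p.2 ∈ M.hetSet}
  continuous_mInv : ∀ d, ∀ θ ∈ M.paramSet,
    ContinuousOn (fun p : M.covSet × ℝ => M.mInv d p.1 p.2 θ)
      {p | p.2 ∈ (fun η => M.m d p.1 η θ) '' M.hetSet}
  k₁_mem_range : ∀ θ ∈ M.paramSet, ∀ x, M.k₁ ∈ (fun η => M.m 1 x η θ) '' M.hetSet

/-- The optimization errors are confined to the window, and the counterfactual choices have
densities bounded above and away from zero. -/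
structure WindowAndDensity [MeasurableSpace Ω] (P : Measure Ω) : Prop where
  window_subset : Icc M.k₀ M.k₁ ⊆ Icc M.yLow M.yUp
  k_mem_window : M.k ∈ Icc M.k₀ M.k₁
  k₀_interior : M.k₀ ∈ Ioo (M.lo 0) (M.hi 0)
  k₁_interior : M.k₁ ∈ Ioo (M.lo 1) (M.hi 1)
  bunchers_in_window : ∀ᵐ ω ∂P, M.Ystar ω = M.k → M.Y ω ∈ Icc M.k₀ M.k₁
  no_error_outside : ∀ᵐ ω ∂P,
    (M.Y ω ∉ Icc M.k₀ M.k₁ ∨ M.Ystar ω ∉ Icc M.k₀ M.k₁) → M.Y ω = M.Ystar ω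
  measurable_f : ∀ d, Measurable (M.f d)
  density : ∀ d, (P.map (M.choice d)).restrict (Icc (M.lo d) (M.hi d)) =
    (volume.restrict (Icc (M.lo d) (M.hi d))).withDensity (fun y => ENNReal.ofReal (M.f d y))
  density_bounds : ∃ c₁ c₂ : ℝ, 0 < c₁ ∧ c₁ ≤ c₂ ∧
    ∀ d, ∀ y ∈ Icc (M.lo d) (M.hi d), c₁ ≤ M.f d y ∧ M.f d y ≤ c₂

/-- `κ` is a (version of the) regular conditional distribution of `X` given `Y*(0)`. -/
def IsCondLaw [MeasurableSpace Ω] (P : Measure Ω) (κ : Kernel ℝ M.covSet) : Prop :=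
  P.map (fun ω => (M.choice 0 ω, M.X ω)) = (P.map (M.choice 0)).compProd κ

/-- The density of `Y*(0)` under the `T`-weighted measure,
`f(y) E[T | Y*(0) = y] / E[T]`. -/
def fT [MeasurableSpace Ω] (P : Measure Ω) (κ : Kernel ℝ M.covSet) (y : ℝ) : ℝ :=
  M.f 0 y * (∫ x, M.t x ∂(κ y)) / ∫ ω, M.T ω ∂P

/-- The conditional `τ`-quantile of `R(k₁, X, θ)` given `Y*(0) = y` under the `T`-weighted
measure. -/
def gT (κ : Kernel ℝ M.covSet) (θ : EuclideanSpace ℝ (Fin dθ)) (τ y : ℝ) : ℝ :=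
  quantile (weighted (κ y) M.t) (fun x => M.reversion M.k₁ x θ) τ

/-- The bunching moment predicted by `θ`. -/
def predictedMoment [MeasurableSpace Ω] (P : Measure Ω) (θ : EuclideanSpace ℝ (Fin dθ)) : ℝ :=
  ∫ ω in {ω | M.k₀ ≤ M.choice 0 ω ∧ M.choice 0 ω ≤ M.reversion M.k₁ (M.X ω) θ}, M.T ω ∂P

/-- The weights are bounded and their conditional mean is bounded away from zero; the analyticity
condition holds on `[k₀, kBar θ]` for every `θ`, where `kBar θ` bounds the reversion for the units
that bunch according to `θ`; the predicted bunching moment is one-to-one in `θ`. -/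
structure IdentificationRegularity [MeasurableSpace Ω] (P : Measure Ω) (κ : Kernel ℝ M.covSet)
    (ρ β δ : ℝ) : Prop where
  t_nonneg : ∀ x, 0 ≤ M.t x
  t_bounds : ∃ c₁ c₂ : ℝ, 0 < c₁ ∧ c₁ ≤ c₂ ∧ (∀ x, M.t x ≤ c₂) ∧
    ∀ y ∈ Icc (M.lo 0) (M.hi 0), c₁ ≤ ∫ x, M.t x ∂(κ y)
  kBar_mem : ∀ θ ∈ M.paramSet, M.kBar θ ∈ Icc M.k (M.hi 0) ∧ M.k₀ < M.kBar θ
  kBar_bound : ∀ θ ∈ M.paramSet,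
    weighted P M.T {ω | M.kBar θ < M.reversion M.k₁ (M.X ω) θ ∧
      M.k₀ ≤ M.choice 0 ω ∧ M.choice 0 ω ≤ M.reversion M.k₁ (M.X ω) θ} = 0
  ρ_pos : 0 < ρ
  β_nonneg : 0 ≤ β
  δ_mem : δ ∈ Ico (0 : ℝ) 1
  analyticity : ∀ θ ∈ M.paramSet,
    AnalyticityCondition M.k₀ (M.kBar θ) (M.fT P κ) (M.gT κ θ) ρ β δ
  one_to_one : InjOn (M.predictedMoment P) M.paramSet

/-- `y ↦ E[T (R(k₁, X, θ) - k₀)^j | Y*(0) = y] f(y)`. -/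
def momentDensity (κ : Kernel ℝ M.covSet) (θ : EuclideanSpace ℝ (Fin dθ)) (j : ℕ) (y : ℝ) : ℝ :=
  (∫ x, M.t x * (M.reversion M.k₁ x θ - M.k₀) ^ j ∂(κ y)) * M.f 0 y

/-- The `(j+1)`-st summand of the series (the summands are counted from one), with the
derivatives taken from the right at `k₀`, since analyticity is imposed on `[k₀, kBar θ]`. -/
def seriesTerm (κ : Kernel ℝ M.covSet) (θ : EuclideanSpace ℝ (Fin dθ)) (j : ℕ) : ℝ :=
  (1 / (Nat.factorial (j + 1) : ℝ)) *
    iteratedDerivWithin j (M.momentDensity κ θ (j + 1)) (Ici M.k₀) M.k₀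

/-- The function `B(θ)`. -/
def B (κ : Kernel ℝ M.covSet) (θ : EuclideanSpace ℝ (Fin dθ)) : ℝ :=
  ∑' j : ℕ, M.seriesTerm κ θ j

end BunchingModel

end

/-!
Fix `θ` and write `a = k₀`, `b = kBar θ`, `R` for the reversion of `k₁` and `g τ y` for the quantile
of `R` given `Y*(0) = y` under the `T`-weighted law, whose density of `Y*(0)` is `f`.

The crossing of the two strictly concave payoffs makes the compound payoff their minimum, so the
desired choice is below `k₀ ≤ k` exactly when `Y*(0)` is and above `k₁ ≥ k` exactly when `Y*(1)` is.
Since optimization errors stay inside the window, `Y` falls into it exactly when `k₀ ≤ Y*(0)` and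
`Y*(1) ≤ k₁`, and by monotonicity in the heterogeneity the latter means `Y*(0) ≤ R` at the true
parameter (`ae_Y_mem_window_iff`). Hence the observed moment is the predicted moment of `θ₀`, and
everything reduces to `B θ = predictedMoment θ`, as the predicted moment is one-to-one.

By the quantile transform (`map_quantile`) the expectations `E[T (R - a) ^ j | Y*(0) = y]` are
averages over `τ ∈ (0, 1)` of `(g τ y - a) ^ j`, and the predicted moment is `E[T]` times the average
over `τ` of the integral of `f` over the points `y ∈ [a, b]` with `y ≤ g τ y`
(`integral_integral_le_quantile`). So the identity can be shown for each level and then averaged.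

For a fixed level it is Lagrange inversion. The same payoff crossing gives `R ≥ k`, so `g τ a ≥ a`,
and the definition of `b` gives `g τ b ≤ b`. At every point with `y ≤ g τ y` the analyticity
condition bounds `|g τ - y|` by `δ ρ` on the circle of radius `ρ`; by Schwarz's lemma `g τ` has
therefore a single fixed point `c`, and the points with `y ≤ g τ y` form `[a, c]`
(`exists_fixedPoint`). As a function of the base point `u`, the partial sum
`∑_{j ≤ l} (1 / j!) D ^ (j - 1) [(g - u) ^ j f] (u)` has the telescoping derivative
`(1 / l!) D ^ l [(g - u) ^ l f] (u) - f u` and vanishes at `u = c`. Integration over `[a, c]`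
expresses the remainder of the series at `a` as `∫_a^c (1 / l!) D ^ l [(g - u) ^ l f] (u) du`, and Cauchy's
formula bounds the integrand by `δ ^ l` times the mean of `|f|` over the circle around `u`
(`norm_integral_sub_partialSum_le`). This proves convergence to `∫_a^c f`, and it gives the error
bound when the circle means are at most `β f u`.

Averaging the derivatives over `τ` is differentiation under the integral sign inside `[a, b]`, where
Cauchy's estimates provide the dominating constants (`contDiffOn_and_iteratedDerivWithin`).
-/

/-! ### Lagrange inversion with remainder -/

namespace LagrangeInversion

open Complex

/-- The `n`-th derivative at `u` of `z ↦ (G z - u) ^ k * F z`, where `u` is also the point at which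
the derivative is taken. -/
noncomputable def movingDeriv (G F : ℂ → ℂ) (n k : ℕ) (u : ℂ) : ℂ :=
  iteratedDeriv n (fun z => (G z - u) ^ k * F z) u

lemma analyticAt_iteratedDeriv {f : ℂ → ℂ} {z : ℂ} (hf : AnalyticAt ℂ f z) (n : ℕ) :
    AnalyticAt ℂ (iteratedDeriv n f) z := by
  induction n with
  | zero => simpa using hf
  | succ n ih => rw [iteratedDeriv_succ]; exact ih.deriv

lemma hasDerivAt_iteratedDeriv {f : ℂ → ℂ} {z : ℂ} (hf : AnalyticAt ℂ f z) (n : ℕ) :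
    HasDerivAt (iteratedDeriv n f) (iteratedDeriv (n + 1) f z) z := by
  rw [iteratedDeriv_succ]
  exact (analyticAt_iteratedDeriv hf n).differentiableAt.hasDerivAt

lemma movingDeriv_pow_succ {G F : ℂ → ℂ} {u : ℂ} (hG : AnalyticAt ℂ G u) (hF : AnalyticAt ℂ F u)
    (n k : ℕ) :
    movingDeriv G F n (k + 1) u =
      movingDeriv G (fun z => G z * F z) n k u - u * movingDeriv G F n k u := by
  have hA : AnalyticAt ℂ (fun z => (G z - u) ^ k * (G z * F z)) u := by fun_prop
  have hB : AnalyticAt ℂ (fun z => (G z - u) ^ k * F z) u := by fun_prop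
  have hC : AnalyticAt ℂ (fun z => u * ((G z - u) ^ k * F z)) u := by fun_prop
  simp only [movingDeriv]
  rw [← iteratedDeriv_const_mul_field u, ← iteratedDeriv_fun_sub hA.contDiffAt hC.contDiffAt]
  congr 1
  funext z
  ring

/-- The derivative in the moving point: a derivative in the point of evaluation plus a derivative
in the parameter. -/
lemma hasDerivAt_movingDeriv {G F : ℂ → ℂ} {U : Set ℂ} (hU : IsOpen U)
    (hG : AnalyticOnNhd ℂ G U) (hF : AnalyticOnNhd ℂ F U) (n k : ℕ) {u : ℂ} (hu : u ∈ U) :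
    HasDerivAt (movingDeriv G F n k)
      (movingDeriv G F (n + 1) k u - k * movingDeriv G F n (k - 1) u) u := by
  induction k generalizing F with
  | zero =>
    have : movingDeriv G F n 0 = iteratedDeriv n F := by funext v; simp [movingDeriv]
    rw [this]
    simpa [movingDeriv] using hasDerivAt_iteratedDeriv (hF u hu) n
  | succ k ih =>
    have hGF : AnalyticOnNhd ℂ (fun z => G z * F z) U := hG.mul hF
    have hev : movingDeriv G F n (k + 1) =ᶠ[nhds u]
        fun v => movingDeriv G (fun z => G z * F z) n k v - v * movingDeriv G F n k v := by
      filter_upwards [hU.mem_nhds hu] with v hv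
      exact movingDeriv_pow_succ (hG v hv) (hF v hv) n k
    refine HasDerivAt.congr_of_eventuallyEq ?_ hev
    convert (ih hGF).fun_sub ((hasDerivAt_id' u).fun_mul (ih hF)) using 1
    rw [movingDeriv_pow_succ (hG u hu) (hF u hu)]
    rcases k with _ | k
    · simp
      ring
    · have h := movingDeriv_pow_succ (hG u hu) (hF u hu) n k
      simp only [Nat.add_sub_cancel] at h ⊢
      rw [h]
      push_cast
      ring

/-- At a fixed point of `G` the function `(G - u) ^ k * F` vanishes to order `k`. -/
lemma movingDeriv_eq_zero {G F : ℂ → ℂ} {u : ℂ} (hG : AnalyticAt ℂ G u) (hF : AnalyticAt ℂ F u)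
    (hfix : G u = u) {n k : ℕ} (hnk : n < k) : movingDeriv G F n k u = 0 := by
  have hGu : AnalyticAt ℂ (fun z => G z - u) u := by fun_prop
  have h1 : 1 ≤ analyticOrderAt (fun z => G z - u) u := by
    rw [Order.one_le_iff_ne_zero, Ne, hGu.analyticOrderAt_eq_zero]
    simp [hfix]
  have hprod : AnalyticAt ℂ (fun z => (G z - u) ^ k * F z) u := by fun_prop
  refine (natCast_le_analyticOrderAt_iff_iteratedDeriv_eq_zero hprod).1 ?_ n hnk
  have : (fun z => (G z - u) ^ k * F z) = (fun z => G z - u) ^ k * F := rfl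
  rw [this, analyticOrderAt_mul (hGu.pow k) hF, analyticOrderAt_pow hGu]
  calc (k : ℕ∞) ≤ k • analyticOrderAt (fun z => G z - u) u := by
        simpa using nsmul_le_nsmul_right h1 k
    _ ≤ _ := le_self_add

/-- The partial sum of the Lagrange series at the base point `u`. -/
noncomputable def partialSum (G F : ℂ → ℂ) (l : ℕ) (u : ℂ) : ℂ :=
  ∑ j ∈ Finset.range l, (1 / ((j + 1).factorial : ℂ)) * movingDeriv G F j (j + 1) u

/-- The derivative of a partial sum in the base point telescopes. -/
lemma hasDerivAt_partialSum {G F : ℂ → ℂ} {U : Set ℂ} (hU : IsOpen U)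
    (hG : AnalyticOnNhd ℂ G U) (hF : AnalyticOnNhd ℂ F U) (l : ℕ) {u : ℂ} (hu : u ∈ U) :
    HasDerivAt (partialSum G F l)
      ((1 / (l.factorial : ℂ)) * movingDeriv G F l l u - F u) u := by
  have h : HasDerivAt (partialSum G F l) (∑ j ∈ Finset.range l, (1 / ((j + 1).factorial : ℂ)) *
      (movingDeriv G F (j + 1) (j + 1) u - (j + 1 : ℕ) * movingDeriv G F j (j + 1 - 1) u)) u :=
    HasDerivAt.fun_sum fun j _ => (hasDerivAt_movingDeriv hU hG hF j (j + 1) hu).const_mul _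
  convert h using 1
  have h0 : F u = (1 / (Nat.factorial 0 : ℂ)) * movingDeriv G F 0 0 u := by simp [movingDeriv]
  rw [h0, ← Finset.sum_range_sub (fun j => (1 / (j.factorial : ℂ)) * movingDeriv G F j j u)]
  refine Finset.sum_congr rfl fun j _ => ?_
  have hj : ((j : ℂ) + 1) ≠ 0 := by exact_mod_cast Nat.succ_ne_zero j
  have hf : (j.factorial : ℂ) ≠ 0 := by exact_mod_cast Nat.factorial_ne_zero j
  rw [Nat.factorial_succ, Nat.add_sub_cancel]
  push_cast
  field_simp

/-- Cauchy's integral formula on the circle of radius `ρ`, as an average over the circle. -/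
lemma norm_iteratedDeriv_le_average {f : ℂ → ℂ} {y ρ : ℝ} (hρ : 0 < ρ)
    (hf : DifferentiableOn ℂ f (Metric.closedBall (y : ℂ) ρ)) (n : ℕ) :
    ‖(1 / (n.factorial : ℂ)) * iteratedDeriv n f y‖ ≤
      (ρ ^ n)⁻¹ * ∫ x in (0 : ℝ)..1, ‖f (circlePoint y ρ x)‖ := by
  have hC := hf.circleIntegral_one_div_sub_center_pow_smul hρ n
  have hf0 : (n.factorial : ℂ) ≠ 0 := by exact_mod_cast Nat.factorial_ne_zero n
  have h1 : ‖∮ z in C((y : ℂ), ρ), (1 / (z - y) ^ (n + 1)) • f z‖ ≤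
      ∫ θ in (0 : ℝ)..2 * Real.pi, (ρ ^ n)⁻¹ * ‖f (circleMap y ρ θ)‖ := by
    rw [circleIntegral]
    refine (intervalIntegral.norm_integral_le_integral_norm Real.two_pi_pos.le).trans_eq ?_
    refine intervalIntegral.integral_congr fun θ _ => ?_
    simp only [smul_eq_mul, norm_mul, deriv_circleMap, norm_I, norm_circleMap_zero, mul_one,
      norm_div, norm_one, norm_pow, circleMap_sub_center, abs_of_pos hρ, pow_succ]
    field_simp
  have h2 : ∫ θ in (0 : ℝ)..2 * Real.pi, (ρ ^ n)⁻¹ * ‖f (circleMap y ρ θ)‖ =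
      2 * Real.pi * ((ρ ^ n)⁻¹ * ∫ x in (0 : ℝ)..1, ‖f (circlePoint y ρ x)‖) := by
    have h := intervalIntegral.smul_integral_comp_mul_left (a := 0) (b := 1)
      (fun θ => (ρ ^ n)⁻¹ * ‖f (circleMap y ρ θ)‖) (2 * Real.pi)
    rw [mul_zero, mul_one, smul_eq_mul] at h
    rw [← h, intervalIntegral.integral_const_mul]
    have hx : ∀ x : ℝ, circleMap y ρ (2 * Real.pi * x) = circlePoint y ρ x := by
      intro x
      simp only [circlePoint, circleMap]
      congr 3
      push_cast
      ring
    simp only [hx]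
  rw [hC, h2, smul_eq_mul] at h1
  have h3 : (2 * (Real.pi : ℂ) * I / n.factorial) * iteratedDeriv n f y =
      (2 * (Real.pi : ℂ) * I) * ((1 / (n.factorial : ℂ)) * iteratedDeriv n f y) := by
    field_simp
  rw [h3, norm_mul] at h1
  have h4 : ‖2 * (Real.pi : ℂ) * I‖ = 2 * Real.pi := by
    simp [abs_of_pos Real.pi_pos]
  rw [h4] at h1
  exact le_of_mul_le_mul_left h1 Real.two_pi_pos

lemma circlePoint_mem_sphere {y ρ : ℝ} (hρ : 0 < ρ) (x : ℝ) :
    circlePoint y ρ x ∈ Metric.sphere (y : ℂ) ρ := by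
  have h : (2 * (Real.pi : ℂ) * I * (x : ℂ)) = ((2 * Real.pi * x : ℝ) : ℂ) * I := by
    push_cast; ring
  rw [mem_sphere_iff_norm, circlePoint, add_sub_cancel_left, h, norm_mul, norm_exp_ofReal_mul_I]
  simp [abs_of_pos hρ]

lemma exists_circlePoint_eq {y ρ : ℝ} (hρ : 0 < ρ) {z : ℂ} (hz : z ∈ Metric.sphere (y : ℂ) ρ) :
    ∃ x ∈ Icc (0 : ℝ) 1, circlePoint y ρ x = z := by
  rw [← abs_of_pos hρ, ← image_circleMap_Ioc] at hz
  obtain ⟨θ, hθ, rfl⟩ := hz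
  have hpi := Real.two_pi_pos
  refine ⟨θ / (2 * Real.pi), ⟨div_nonneg hθ.1.le hpi.le, (div_le_one hpi).2 hθ.2⟩, ?_⟩
  have hpi' : (Real.pi : ℂ) ≠ 0 := by exact_mod_cast Real.pi_ne_zero
  simp only [circlePoint, circleMap]
  congr 3
  push_cast
  field_simp

end LagrangeInversion

namespace IsAnalyticContinuation

variable {a b ρ : ℝ} {h : ℝ → ℝ} {H : ℂ → ℂ}

lemma exists_open (hH : IsAnalyticContinuation a b ρ h H) :
    ∃ U : Set ℂ, IsOpen U ∧ AnalyticOnNhd ℂ H U ∧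
      ∀ y ∈ Icc a b, Metric.closedBall (y : ℂ) ρ ⊆ U := by
  obtain ⟨⟨R, hR, hd⟩, -⟩ := hH
  refine ⟨_, Metric.isOpen_thickening, hd.analyticOnNhd Metric.isOpen_thickening, ?_⟩
  intro y hy z hz
  rw [Metric.mem_thickening_iff]
  exact ⟨y, mem_image_of_mem _ hy, (Metric.mem_closedBall.1 hz).trans_lt hR⟩

lemma differentiableOn_closedBall (hH : IsAnalyticContinuation a b ρ h H) {y : ℝ}
    (hy : y ∈ Icc a b) : DifferentiableOn ℂ H (Metric.closedBall (y : ℂ) ρ) := by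
  obtain ⟨U, -, hA, hU⟩ := hH.exists_open
  exact hA.differentiableOn.mono (hU y hy)

lemma analyticAt (hH : IsAnalyticContinuation a b ρ h H) (hρ : 0 < ρ) {y : ℝ}
    (hy : y ∈ Icc a b) : AnalyticAt ℂ H y := by
  obtain ⟨U, -, hA, hU⟩ := hH.exists_open
  exact hA _ (hU y hy (Metric.mem_closedBall_self hρ.le))

lemma continuousOn (hH : IsAnalyticContinuation a b ρ h H) (hρ : 0 < ρ) :
    ContinuousOn h (Icc a b) := by
  have h1 : ContinuousOn (fun y : ℝ => (H y).re) (Icc a b) := fun y hy =>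
    (Complex.continuous_re.continuousAt.comp ((hH.analyticAt hρ hy).continuousAt.comp
      Complex.continuous_ofReal.continuousAt)).continuousWithinAt
  refine h1.congr fun y hy => ?_
  simp [hH.2 y hy]

/-- An analytic continuation is bounded on the circles of radius `ρ` around the points of
`[a, b]`, since their union lies in a compact set. -/
lemma exists_bound (hH : IsAnalyticContinuation a b ρ h H) (hρ : 0 < ρ) :
    ∃ C : ℝ, 0 ≤ C ∧ ∀ y ∈ Icc a b, ∀ z ∈ Metric.sphere (y : ℂ) ρ, ‖H z‖ ≤ C := by
  have hK : IsCompact ((fun y : ℝ => (y : ℂ)) '' Icc a b) :=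
    isCompact_Icc.image Complex.continuous_ofReal
  have hT : IsCompact (Metric.cthickening ρ ((fun y : ℝ => (y : ℂ)) '' Icc a b)) := hK.cthickening
  obtain ⟨⟨R, hR, hd⟩, -⟩ := hH
  have hc : ContinuousOn H (Metric.cthickening ρ ((fun y : ℝ => (y : ℂ)) '' Icc a b)) :=
    hd.continuousOn.mono (Metric.cthickening_subset_thickening' (hρ.trans hR) hR _)
  obtain ⟨C, hC⟩ := hT.exists_bound_of_continuousOn hc
  refine ⟨max C 0, le_max_right _ _, fun y hy z hz => (hC z ?_).trans (le_max_left _ _)⟩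
  exact Metric.mem_cthickening_of_dist_le z y ρ _ (mem_image_of_mem _ hy) (Metric.mem_sphere.1 hz).le

end IsAnalyticContinuation

namespace LagrangeInversion

open Complex

variable {a b ρ δ : ℝ} {f g : ℝ → ℝ} {F G : ℂ → ℂ}

/-- If `G` maps the circle of radius `ρ` around each `y ∈ [a, b]` with `y ≤ g y` into the disc of
radius `δ ρ < ρ` around `y`, then by Schwarz's lemma `g` contracts towards each of its fixed points.
So `g - id` crosses zero downwards only, hence once. -/
lemma exists_fixedPoint (hρ : 0 < ρ) (hab : a ≤ b) (hδ : δ < 1)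
    (hG : IsAnalyticContinuation a b ρ g G) (ha : a ≤ g a) (hb : g b ≤ b)
    (hcontr : ∀ y ∈ Icc a b, y ≤ g y → ∀ z ∈ Metric.sphere (y : ℂ) ρ, ‖G z - y‖ ≤ δ * ρ) :
    ∃ c ∈ Icc a b, g c = c ∧ ∀ y ∈ Icc a b, y ≤ g y ↔ y ≤ c := by
  have hcont := hG.continuousOn hρ
  have hschwarz : ∀ s ∈ Icc a b, g s = s → ∀ y ∈ Icc a b, |y - s| < ρ →
      |g y - s| ≤ δ * |y - s| := by
    intro s hs hfix y hy hsy
    have hGs : G s = s := by rw [hG.2 s hs, hfix]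
    have hdiff := hG.differentiableOn_closedBall hs
    have hball : ∀ z ∈ Metric.closedBall (s : ℂ) ρ, ‖G z - s‖ ≤ δ * ρ := by
      intro z hz
      refine Complex.norm_le_of_forall_mem_frontier_norm_le (f := fun z => G z - s)
        Metric.isBounded_ball (U := Metric.ball (s : ℂ) ρ) ?_ ?_ ?_
      · refine DifferentiableOn.diffContOnCl ?_
        rw [closure_ball _ hρ.ne']
        exact hdiff.sub_const _
      · rw [frontier_ball _ hρ.ne']
        exact hcontr s hs hfix.ge
      · rwa [closure_ball _ hρ.ne']
    have hyb : (y : ℂ) ∈ Metric.ball (s : ℂ) ρ := by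
      rwa [Metric.mem_ball, dist_eq, ← ofReal_sub, norm_real, Real.norm_eq_abs]
    have hS := Complex.dist_le_div_mul_dist_of_mapsTo_ball (f := G) (R₂ := δ * ρ)
      (hdiff.mono Metric.ball_subset_closedBall) (fun z hz => by
        rw [Metric.mem_closedBall, dist_eq, hGs]
        exact hball z (Metric.ball_subset_closedBall hz)) hyb
    rwa [hGs, hG.2 y hy, dist_eq, dist_eq, ← ofReal_sub, ← ofReal_sub, norm_real, norm_real,
      mul_div_assoc, div_self hρ.ne', mul_one, Real.norm_eq_abs, Real.norm_eq_abs] at hS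
  -- just left of a fixed point `g` lies above the diagonal, so it cannot return to it from below
  have hdown : ∀ y₀ ∈ Icc a b, g y₀ < y₀ → ∀ y ∈ Icc y₀ b, g y < y := by
    intro y₀ hy₀ hlt
    by_contra! hne
    obtain ⟨y₁, hy₁, hy₁g⟩ := hne
    set S : Set ℝ := {y ∈ Icc y₀ b | y - g y ≤ 0} with hS
    have hsub : Icc y₀ b ⊆ Icc a b := Icc_subset_Icc_left hy₀.1
    have hcont' : ContinuousOn (fun y => y - g y) (Icc y₀ b) :=
      continuousOn_id.sub (hcont.mono hsub)
    have hScl : IsClosed S := hcont'.preimage_isClosed_of_isClosed isClosed_Icc isClosed_Iic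
    have hSne : S.Nonempty := ⟨y₁, hy₁, by linarith⟩
    have hSbdd : BddBelow S := ⟨y₀, fun y hy => hy.1.1⟩
    set s := sInf S
    have hsS : s ∈ S := hScl.csInf_mem hSne hSbdd
    have hy₀s : y₀ < s := lt_of_le_of_ne hsS.1.1 fun h => by
      have := hsS.2; rw [← h] at this; linarith
    have hfix : g s = s := by
      by_contra hne
      have hs2 : s - g s < 0 := lt_of_le_of_ne hsS.2 fun h => hne (by linarith)
      obtain ⟨t, ht, ht0⟩ := intermediate_value_Icc' hy₀s.le
        (hcont'.mono (Icc_subset_Icc_right hsS.1.2)) (show (0 : ℝ) ∈ Icc (s - g s) (y₀ - g y₀) from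
          ⟨hs2.le, by linarith⟩)
      have hts : s ≤ t := csInf_le hSbdd ⟨⟨ht.1, ht.2.trans hsS.1.2⟩, ht0.le⟩
      have : t = s := le_antisymm ht.2 hts
      rw [this] at ht0
      simp only at ht0
      linarith
    obtain ⟨y, hy1, hy2⟩ := exists_between (max_lt hy₀s (sub_lt_self s hρ))
    have hyI : y ∈ Icc y₀ b := ⟨(le_max_left _ _).trans hy1.le, hy2.le.trans hsS.1.2⟩
    have hys : |y - s| = s - y := by rw [abs_sub_comm, abs_of_pos (sub_pos.2 hy2)]
    have hρy : s - ρ < y := (le_max_right _ _).trans_lt hy1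
    have hgy := hschwarz s (hsub hsS.1) hfix y (hsub hyI) (by rw [hys]; linarith)
    rw [hys] at hgy
    have hgy' := (abs_le.1 hgy).1
    have : δ * (s - y) < 1 * (s - y) := mul_lt_mul_of_pos_right hδ (sub_pos.2 hy2)
    exact absurd (csInf_le hSbdd (show y ∈ S from ⟨hyI, by linarith⟩)) (not_le.2 hy2)
  obtain ⟨c, hc, hc0⟩ := intermediate_value_Icc' (f := fun y => g y - y) hab
    (hcont.sub continuousOn_id) (show (0 : ℝ) ∈ Icc (g b - b) (g a - a) from
      ⟨by linarith, by linarith⟩)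
  have hfix : g c = c := by simpa [sub_eq_zero] using hc0
  refine ⟨c, hc, hfix, fun y hy => ⟨fun hyg => ?_, fun hyc => ?_⟩⟩
  · by_contra! hcy
    obtain ⟨w, hw1, hw2⟩ := exists_between (lt_min hcy (lt_add_of_pos_right c hρ))
    have hwy : w ≤ y := hw2.le.trans (min_le_left _ _)
    have hwρ : w < c + ρ := hw2.trans_le (min_le_right _ _)
    have hwI : w ∈ Icc a b := ⟨hc.1.trans hw1.le, hwy.trans hy.2⟩
    have hwc : |w - c| = w - c := abs_of_pos (sub_pos.2 hw1)
    have hgw := hschwarz c hc hfix w hwI (by rw [hwc]; linarith)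
    rw [hwc] at hgw
    have hgw' := (abs_le.1 hgw).2
    have : δ * (w - c) < 1 * (w - c) := mul_lt_mul_of_pos_right hδ (sub_pos.2 hw1)
    exact absurd (hdown w hwI (by linarith) y ⟨hwy, hy.2⟩) (not_lt.2 hyg)
  · by_contra! hlt
    have := hdown y hy hlt c ⟨hyc, hc.2⟩
    linarith

/-- **Lagrange inversion with remainder.** The integral of `f` up to the fixed point `c` of `g`
differs from the `l`-th partial sum of the Lagrange series at `a` by the integral over `[a, c]` of
`u ↦ (1 / l!) D ^ l [(g - u) ^ l f] (u)`, and Cauchy's formula bounds this integrand by `δ ^ l`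
times the mean of `|F|` over a circle. The function `Φ` is any integrable bound for these means. -/
theorem norm_integral_sub_partialSum_le (hρ : 0 < ρ) (hab : a ≤ b) (hδ : δ ∈ Ico (0 : ℝ) 1)
    (hF : IsAnalyticContinuation a b ρ f F) (hG : IsAnalyticContinuation a b ρ g G)
    (ha : a ≤ g a) (hb : g b ≤ b)
    (hcontr : ∀ y ∈ Icc a b, y ≤ g y → ∀ z ∈ Metric.sphere (y : ℂ) ρ, ‖G z - y‖ ≤ δ * ρ)
    {Φ : ℝ → ℝ} (hΦ : ContinuousOn Φ (Icc a b))
    (hFΦ : ∀ y ∈ Icc a b, ∫ x in (0 : ℝ)..1, ‖F (circlePoint y ρ x)‖ ≤ Φ y) (l : ℕ) :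
    ‖((∫ y in Icc a b ∩ {y | y ≤ g y}, f y : ℝ) : ℂ) - partialSum G F l a‖ ≤
      δ ^ l * ∫ y in Icc a b ∩ {y | y ≤ g y}, Φ y := by
  obtain ⟨c, hc, hfix, hiff⟩ := exists_fixedPoint hρ hab hδ.2 hG ha hb hcontr
  have hset : Icc a b ∩ {y | y ≤ g y} = Icc a c := by
    ext y
    simp only [mem_inter_iff, mem_ofPred_eq, mem_Icc]
    constructor
    · rintro ⟨hy, hyg⟩
      exact ⟨hy.1, (hiff y hy).1 hyg⟩
    · rintro ⟨h1, h2⟩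
      exact ⟨⟨h1, h2.trans hc.2⟩, (hiff y ⟨h1, h2.trans hc.2⟩).2 h2⟩
  rw [hset, integral_Icc_eq_integral_Ioc, integral_Icc_eq_integral_Ioc,
    ← intervalIntegral.integral_of_le hc.1, ← intervalIntegral.integral_of_le hc.1,
    ← intervalIntegral.integral_ofReal]
  have hsub : Icc a c ⊆ Icc a b := Icc_subset_Icc_right hc.2
  obtain ⟨U₁, hU₁, hFA, hUF⟩ := hF.exists_open
  obtain ⟨U₂, hU₂, hGA, hUG⟩ := hG.exists_open
  have hUo : IsOpen (U₁ ∩ U₂) := hU₁.inter hU₂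
  have hGA' := hGA.mono (inter_subset_right (s := U₁))
  have hFA' := hFA.mono (inter_subset_left (t := U₂))
  have hmem : ∀ y ∈ Icc a b, (y : ℂ) ∈ U₁ ∩ U₂ := fun y hy =>
    ⟨hUF y hy (Metric.mem_closedBall_self hρ.le), hUG y hy (Metric.mem_closedBall_self hρ.le)⟩
  set r : ℝ → ℂ := fun u => (1 / (l.factorial : ℂ)) * movingDeriv G F l l u with hr
  have hrcont : ContinuousOn r (Icc a c) := fun u hu =>
    (((hasDerivAt_movingDeriv hUo hGA' hFA' l l (hmem u (hsub hu))).comp_ofReal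
      ).continuousAt.const_mul _).continuousWithinAt
  have hFcont : ContinuousOn (fun u : ℝ => F u) (Icc a c) := fun u hu =>
    ((hF.analyticAt hρ (hsub hu)).continuousAt.comp
      Complex.continuous_ofReal.continuousAt).continuousWithinAt
  have hftc : ∫ u in a..c, (r u - F u) = partialSum G F l c - partialSum G F l a :=
    intervalIntegral.integral_eq_sub_of_hasDerivAt (f := fun u : ℝ => partialSum G F l u)
      (fun u hu => by
        rw [uIcc_of_le hc.1] at hu
        exact (hasDerivAt_partialSum hUo hGA' hFA' l (hmem u (hsub hu))).comp_ofReal)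
      ((hrcont.sub hFcont).intervalIntegrable_of_Icc hc.1)
  have hc0 : partialSum G F l c = 0 := Finset.sum_eq_zero fun j _ => by
    rw [movingDeriv_eq_zero (hG.analyticAt hρ hc) (hF.analyticAt hρ hc)
      (by rw [hG.2 c hc, hfix]) (Nat.lt_succ_self j), mul_zero]
  have hfF : ∫ u in a..c, (f u : ℂ) = ∫ u in a..c, F u :=
    intervalIntegral.integral_congr fun u hu => by
      rw [uIcc_of_le hc.1] at hu
      exact (hF.2 u (hsub hu)).symm
  rw [intervalIntegral.integral_sub (hrcont.intervalIntegrable_of_Icc hc.1)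
    (hFcont.intervalIntegrable_of_Icc hc.1), hc0, zero_sub] at hftc
  have hrem : (∫ u in a..c, (f u : ℂ)) - partialSum G F l a = ∫ u in a..c, r u := by
    rw [hfF]
    linear_combination -hftc
  rw [hrem, ← intervalIntegral.integral_const_mul]
  have hbound : ∀ u ∈ Icc a c, ‖r u‖ ≤ δ ^ l * Φ u := by
    intro u hu
    have hu' := hsub hu
    have hcu := hcontr u hu' ((hiff u hu').2 hu.2)
    refine (norm_iteratedDeriv_le_average hρ (((hG.differentiableOn_closedBall hu').sub_const _).pow l
      |>.mul (hF.differentiableOn_closedBall hu')) l).trans ?_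
    have hFc : Continuous fun x => ‖F (circlePoint u ρ x)‖ := by
      refine continuous_norm.comp ((hF.differentiableOn_closedBall hu').continuousOn.comp_continuous
        (by unfold circlePoint; fun_prop) fun x => ?_)
      exact Metric.sphere_subset_closedBall (circlePoint_mem_sphere hρ x)
    have hGc : Continuous fun x => ‖(G (circlePoint u ρ x) - u) ^ l * F (circlePoint u ρ x)‖ := by
      refine continuous_norm.comp ((((hG.differentiableOn_closedBall hu').sub_const _).pow l
        |>.mul (hF.differentiableOn_closedBall hu')).continuousOn.comp_continuous
        (by unfold circlePoint; fun_prop) fun x => ?_)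
      exact Metric.sphere_subset_closedBall (circlePoint_mem_sphere hρ x)
    have hmono : ∫ x in (0 : ℝ)..1, ‖(G (circlePoint u ρ x) - u) ^ l * F (circlePoint u ρ x)‖ ≤
        ∫ x in (0 : ℝ)..1, (δ * ρ) ^ l * ‖F (circlePoint u ρ x)‖ := by
      refine intervalIntegral.integral_mono_on zero_le_one (hGc.intervalIntegrable _ _)
        ((continuous_const.mul hFc).intervalIntegrable _ _) fun x _ => ?_
      rw [norm_mul, norm_pow]
      gcongr
      exact hcu _ (circlePoint_mem_sphere hρ x)
    rw [intervalIntegral.integral_const_mul] at hmono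
    calc (ρ ^ l)⁻¹ * ∫ x in (0 : ℝ)..1, ‖(G (circlePoint u ρ x) - u) ^ l * F (circlePoint u ρ x)‖
        ≤ (ρ ^ l)⁻¹ * ((δ * ρ) ^ l * ∫ x in (0 : ℝ)..1, ‖F (circlePoint u ρ x)‖) := by gcongr
      _ = δ ^ l * ∫ x in (0 : ℝ)..1, ‖F (circlePoint u ρ x)‖ := by
        rw [mul_pow]
        field_simp
      _ ≤ δ ^ l * Φ u := mul_le_mul_of_nonneg_left (hFΦ u hu') (pow_nonneg hδ.1 l)
  refine (intervalIntegral.norm_integral_le_integral_norm hc.1).trans ?_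
  exact intervalIntegral.integral_mono_on hc.1 (hrcont.norm.intervalIntegrable_of_Icc hc.1)
    ((continuousOn_const.mul (hΦ.mono hsub)).intervalIntegrable_of_Icc hc.1) hbound

end LagrangeInversion

/-! ### Derivatives of averages of analytic functions -/

namespace AnalyticAverage

open Filter Topology LagrangeInversion

variable {α : Type*} [MeasurableSpace α] {μ : Measure α} {K : α → ℂ → ℂ} {a b ρ C : ℝ}

lemma hasDerivAt_iteratedDeriv_ofReal {f : ℂ → ℂ} {y : ℝ} (hρ : 0 < ρ)
    (hf : DifferentiableOn ℂ f (Metric.closedBall (y : ℂ) ρ)) (n : ℕ) :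
    HasDerivAt (fun x : ℝ => iteratedDeriv n f x) (iteratedDeriv (n + 1) f y) y :=
  (hasDerivAt_iteratedDeriv (hf.analyticAt (Metric.closedBall_mem_nhds _ hρ)) n).comp_ofReal

/-- Measurability in the parameter passes to derivatives, which are limits of difference
quotients at points of the interval. -/
lemma aestronglyMeasurable_iteratedDeriv (hρ : 0 < ρ) (hab : a < b)
    (hd : ∀ᵐ t ∂μ, ∀ y ∈ Icc a b, DifferentiableOn ℂ (K t) (Metric.closedBall (y : ℂ) ρ))
    (hm : ∀ y ∈ Icc a b, AEStronglyMeasurable (fun t => K t (y : ℂ)) μ) (n : ℕ) :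
    ∀ y ∈ Icc a b, AEStronglyMeasurable (fun t => iteratedDeriv n (K t) (y : ℂ)) μ := by
  induction n with
  | zero => simpa using hm
  | succ n ih =>
    intro y hy
    have hcl : y ∈ closure (Icc a b \ {y}) := mem_closure_iff_clusterPt.2
      (accPt_principal_iff_clusterPt.1 (uniqueDiffOn_Icc hab y hy).accPt)
    obtain ⟨u, hu, hlim⟩ := mem_closure_iff_seq_limit.1 hcl
    refine aestronglyMeasurable_of_tendsto_ae atTop
      (f := fun i t => slope (fun x : ℝ => iteratedDeriv n (K t) (x : ℂ)) y (u i)) (fun i => ?_) ?_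
    · simp only [slope, vsub_eq_sub]
      exact ((ih _ (hu i).1).sub (ih y hy)).const_smul _
    · filter_upwards [hd] with t ht
      refine (hasDerivAt_iff_tendsto_slope.1
        (hasDerivAt_iteratedDeriv_ofReal hρ (ht y hy) n)).comp ?_
      exact tendsto_nhdsWithin_iff.2 ⟨hlim, Eventually.of_forall fun i => (hu i).2⟩

/-- Cauchy's estimate, uniformly in the parameter. -/
lemma norm_iteratedDeriv_le (hρ : 0 < ρ)
    (hd : ∀ᵐ t ∂μ, ∀ y ∈ Icc a b, DifferentiableOn ℂ (K t) (Metric.closedBall (y : ℂ) ρ))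
    (hC : ∀ᵐ t ∂μ, ∀ y ∈ Icc a b, ∀ z ∈ Metric.sphere (y : ℂ) ρ, ‖K t z‖ ≤ C) (n : ℕ) :
    ∀ᵐ t ∂μ, ∀ y ∈ Icc a b, ‖iteratedDeriv n (K t) (y : ℂ)‖ ≤ n.factorial * C / ρ ^ n := by
  filter_upwards [hd, hC] with t htd htC y hy
  exact Complex.norm_iteratedDeriv_le_of_forall_mem_sphere_norm_le n hρ
    (DifferentiableOn.diffContOnCl (by rw [closure_ball _ hρ.ne']; exact htd y hy)) (htC y hy)

lemma integrable_iteratedDeriv [IsFiniteMeasure μ] (hρ : 0 < ρ) (hab : a < b)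
    (hd : ∀ᵐ t ∂μ, ∀ y ∈ Icc a b, DifferentiableOn ℂ (K t) (Metric.closedBall (y : ℂ) ρ))
    (hC : ∀ᵐ t ∂μ, ∀ y ∈ Icc a b, ∀ z ∈ Metric.sphere (y : ℂ) ρ, ‖K t z‖ ≤ C)
    (hm : ∀ y ∈ Icc a b, AEStronglyMeasurable (fun t => K t (y : ℂ)) μ) (n : ℕ)
    {y : ℝ} (hy : y ∈ Icc a b) : Integrable (fun t => iteratedDeriv n (K t) (y : ℂ)) μ :=
  Integrable.of_bound (aestronglyMeasurable_iteratedDeriv hρ hab hd hm n y hy) _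
    ((norm_iteratedDeriv_le hρ hd hC n).mono fun _ ht => ht y hy)

/-- Differentiation under the integral sign, within the interval. -/
lemma hasDerivWithinAt_integral [IsFiniteMeasure μ] (hρ : 0 < ρ) (hab : a < b)
    (hd : ∀ᵐ t ∂μ, ∀ y ∈ Icc a b, DifferentiableOn ℂ (K t) (Metric.closedBall (y : ℂ) ρ))
    (hC : ∀ᵐ t ∂μ, ∀ y ∈ Icc a b, ∀ z ∈ Metric.sphere (y : ℂ) ρ, ‖K t z‖ ≤ C)
    (hm : ∀ y ∈ Icc a b, AEStronglyMeasurable (fun t => K t (y : ℂ)) μ) (n : ℕ)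
    {y : ℝ} (hy : y ∈ Icc a b) :
    HasDerivWithinAt (fun x : ℝ => ∫ t, iteratedDeriv n (K t) (x : ℂ) ∂μ)
      (∫ t, iteratedDeriv (n + 1) (K t) (y : ℂ) ∂μ) (Icc a b) y := by
  rw [hasDerivWithinAt_iff_tendsto_slope]
  have hint : ∀ x ∈ Icc a b, Integrable (fun t => iteratedDeriv n (K t) (x : ℂ)) μ :=
    fun x hx => integrable_iteratedDeriv hρ hab hd hC hm n hx
  have hslope : ∀ᶠ x in 𝓝[Icc a b \ {y}] y,
      ∫ t, slope (fun x : ℝ => iteratedDeriv n (K t) (x : ℂ)) y x ∂μ =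
        slope (fun x : ℝ => ∫ t, iteratedDeriv n (K t) (x : ℂ) ∂μ) y x := by
    filter_upwards [self_mem_nhdsWithin] with x hx
    simp only [slope, vsub_eq_sub]
    rw [integral_smul, integral_sub (hint x hx.1) (hint y hy)]
  refine Tendsto.congr' hslope ?_
  refine tendsto_integral_filter_of_dominated_convergence
    (fun _ => (n + 1).factorial * C / ρ ^ (n + 1)) ?_ ?_ (integrable_const _) ?_
  · filter_upwards [self_mem_nhdsWithin] with x hx
    simp only [slope, vsub_eq_sub]
    exact (((hint x hx.1).sub (hint y hy)).smul _).aestronglyMeasurable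
  · filter_upwards [self_mem_nhdsWithin] with x hx
    filter_upwards [hd, norm_iteratedDeriv_le hρ hd hC (n + 1)] with t htd htb
    have hxy : 0 < ‖x - y‖ := norm_pos_iff.2 (sub_ne_zero.2 hx.2)
    have h := Convex.norm_image_sub_le_of_norm_hasDerivWithin_le
      (f := fun x : ℝ => iteratedDeriv n (K t) (x : ℂ))
      (fun w hw => (hasDerivAt_iteratedDeriv_ofReal hρ (htd w hw) n).hasDerivWithinAt)
      (fun w hw => htb w hw) (convex_Icc a b) hy hx.1
    rw [slope, vsub_eq_sub, norm_smul, norm_inv, inv_mul_le_iff₀ hxy, mul_comm]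
    exact h
  · filter_upwards [hd] with t htd
    exact ((hasDerivWithinAt_iff_tendsto_slope).1
      (hasDerivAt_iteratedDeriv_ofReal hρ (htd y hy) n).hasDerivWithinAt)

lemma iteratedDerivWithin_of_hasDerivWithinAt {φ : ℕ → ℝ → ℝ} (hab : a < b)
    (hφ : ∀ n, ∀ y ∈ Icc a b, HasDerivWithinAt (φ n) (φ (n + 1) y) (Icc a b) y) (n : ℕ) :
    ∀ y ∈ Icc a b, iteratedDerivWithin n (φ 0) (Icc a b) y = φ n y := by
  induction n with
  | zero => simp
  | succ n ih =>
    intro y hy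
    rw [iteratedDerivWithin_succ, derivWithin_congr ih (ih y hy)]
    exact (hφ n y hy).derivWithin (uniqueDiffOn_Icc hab y hy)

/-- A real function which is an average of uniformly bounded analytic functions is smooth, and its
derivatives are the averages of the derivatives. -/
lemma contDiffOn_and_iteratedDerivWithin [IsFiniteMeasure μ] (hρ : 0 < ρ) (hab : a < b)
    (hd : ∀ᵐ t ∂μ, ∀ y ∈ Icc a b, DifferentiableOn ℂ (K t) (Metric.closedBall (y : ℂ) ρ))
    (hC : ∀ᵐ t ∂μ, ∀ y ∈ Icc a b, ∀ z ∈ Metric.sphere (y : ℂ) ρ, ‖K t z‖ ≤ C)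
    (hm : ∀ y ∈ Icc a b, AEStronglyMeasurable (fun t => K t (y : ℂ)) μ)
    {k : ℝ → ℝ} (hk : ∀ y ∈ Icc a b, k y = (∫ t, K t (y : ℂ) ∂μ).re) :
    ContDiffOn ℝ (⊤ : ℕ∞) k (Icc a b) ∧ ∀ n, ∀ y ∈ Icc a b,
      iteratedDerivWithin n k (Icc a b) y = (∫ t, iteratedDeriv n (K t) (y : ℂ) ∂μ).re := by
  set φ : ℕ → ℝ → ℝ := fun n y => (∫ t, iteratedDeriv n (K t) (y : ℂ) ∂μ).re with hφdef
  have hφ : ∀ n, ∀ y ∈ Icc a b, HasDerivWithinAt (φ n) (φ (n + 1) y) (Icc a b) y := by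
    intro n y hy
    exact Complex.reCLM.hasFDerivAt.comp_hasDerivWithinAt y
      (hasDerivWithinAt_integral hρ hab hd hC hm n hy)
  have hk0 : EqOn k (φ 0) (Icc a b) := fun y hy => by simpa [hφdef] using hk y hy
  have hder : ∀ n, ∀ y ∈ Icc a b, iteratedDerivWithin n k (Icc a b) y = φ n y := fun n y hy => by
    rw [iteratedDerivWithin_congr hk0 hy]
    exact iteratedDerivWithin_of_hasDerivWithinAt hab hφ n y hy
  refine ⟨contDiffOn_of_differentiableOn_deriv fun n _ y hy => ?_, hder⟩
  exact (hφ n y hy).differentiableWithinAt.congr (hder n) (hder n y hy)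

/-- A derivative within `[a, b]` at the left endpoint `a` is a derivative from the right. -/
lemma iteratedDerivWithin_Ici_left (hab : a < b) (n : ℕ) (k : ℝ → ℝ) :
    iteratedDerivWithin n k (Ici a) a = iteratedDerivWithin n k (Icc a b) a := by
  rw [iteratedDerivWithin, iteratedDerivWithin, ← Ici_inter_Iic,
    iteratedFDerivWithin_inter (Iic_mem_nhds hab)]

end AnalyticAverage

/-! ### Quantiles -/

section Quantile

open Filter Topology

variable {α : Type*} [MeasurableSpace α]

/-- The quantile function is the lower adjoint of the distribution function. -/
lemma quantile_le_iff (ν : Measure α) [IsProbabilityMeasure ν] {W : α → ℝ} (hW : Measurable W)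
    {τ : ℝ} (hτ : τ ∈ Ioo (0 : ℝ) 1) (w : ℝ) :
    quantile ν W τ ≤ w ↔ τ ≤ ν.real {x | W x ≤ w} := by
  have : IsProbabilityMeasure (ν.map W) := Measure.isProbabilityMeasure_map hW.aemeasurable
  have hF : ∀ w, ν.real {x | W x ≤ w} = cdf (ν.map W) w := fun w => by
    rw [cdf_eq_real, map_measureReal_apply hW measurableSet_Iic]
    rfl
  simp only [quantile, hF]
  set S : Set ℝ := {w | τ ≤ cdf (ν.map W) w} with hS
  have hne : S.Nonempty :=
    ((tendsto_cdf_atTop (ν.map W)).eventually (eventually_ge_nhds hτ.2)).exists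
  have hbdd : BddBelow S := by
    obtain ⟨v, hv⟩ := ((tendsto_cdf_atBot (ν.map W)).eventually (eventually_lt_nhds hτ.1)).exists
    refine ⟨v, fun w hw => ?_⟩
    by_contra! hlt
    have := monotone_cdf (ν.map W) hlt.le
    exact absurd (hv.trans_le (hw.trans this)) (lt_irrefl _)
  have hmem : τ ≤ cdf (ν.map W) (sInf S) := by
    rw [← StieltjesFunction.iInf_Ioi_eq]
    have : Nonempty (Ioi (sInf S)) := nonempty_Ioi.to_subtype
    refine le_ciInf fun v => ?_
    obtain ⟨w, hw, hwv⟩ := exists_lt_of_csInf_lt hne v.2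
    exact hw.trans (monotone_cdf _ hwv.le)
  exact ⟨fun h => hmem.trans (monotone_cdf _ h), fun h => csInf_le hbdd h⟩

lemma quantile_monotoneOn (ν : Measure α) [IsProbabilityMeasure ν] {W : α → ℝ}
    (hW : Measurable W) : MonotoneOn (quantile ν W) (Ioo 0 1) := fun _ h₁ _ h₂ h =>
  (quantile_le_iff ν hW h₁ _).2 (h.trans ((quantile_le_iff ν hW h₂ _).1 le_rfl))

lemma aemeasurable_quantile (ν : Measure α) [IsProbabilityMeasure ν] {W : α → ℝ}
    (hW : Measurable W) : AEMeasurable (quantile ν W) (volume.restrict (Ioo 0 1)) :=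
  aemeasurable_restrict_of_monotoneOn measurableSet_Ioo (quantile_monotoneOn ν hW)

/-- The quantile transform: the quantile of a uniform level has the law of `W`. -/
lemma map_quantile (ν : Measure α) [IsProbabilityMeasure ν] {W : α → ℝ} (hW : Measurable W) :
    (volume.restrict (Ioo (0 : ℝ) 1)).map (quantile ν W) = ν.map W := by
  have : IsProbabilityMeasure (ν.map W) := Measure.isProbabilityMeasure_map hW.aemeasurable
  refine (Measure.ext_of_Iic _ _ fun w => ?_).symm
  have hset : (quantile ν W ⁻¹' Iic w) ∩ Ioo 0 1 = Iic (ν.real {x | W x ≤ w}) ∩ Ioo 0 1 := by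
    ext τ
    simp only [mem_inter_iff, mem_preimage, mem_Iic]
    exact and_congr_left fun hτ => quantile_le_iff ν hW hτ w
  rw [Measure.map_apply hW measurableSet_Iic,
    Measure.map_apply_of_aemeasurable (aemeasurable_quantile ν hW) measurableSet_Iic,
    Measure.restrict_apply' measurableSet_Ioo, hset]
  have hp1 : ν.real {x | W x ≤ w} ≤ 1 := measureReal_le_one
  have hpre : W ⁻¹' Iic w = {x | W x ≤ w} := rfl
  rw [hpre, ← ofReal_measureReal]
  rcases hp1.eq_or_lt with h1 | h1
  · rw [h1, inter_eq_right.2 (fun x hx => hx.2.le), Real.volume_Ioo, sub_zero]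
  · have : Iic (ν.real {x | W x ≤ w}) ∩ Ioo 0 1 = Ioc 0 (ν.real {x | W x ≤ w}) := by
      ext τ
      simp only [mem_inter_iff, mem_Iic, mem_Ioo, mem_Ioc]
      exact ⟨fun h => ⟨h.2.1, h.1⟩, fun h => ⟨h.2, h.1, h.2.trans_lt h1⟩⟩
    rw [this, Real.volume_Ioc, sub_zero]

lemma integral_comp_quantile (ν : Measure α) [IsProbabilityMeasure ν] {W : α → ℝ}
    (hW : Measurable W) {φ : ℝ → ℝ} (hφ : Measurable φ) :
    ∫ τ in Ioo (0 : ℝ) 1, φ (quantile ν W τ) = ∫ x, φ (W x) ∂ν := by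
  rw [← integral_map (aemeasurable_quantile ν hW) hφ.aestronglyMeasurable, map_quantile ν hW,
    integral_map hW.aemeasurable hφ.aestronglyMeasurable]

/-- Integrating a function over the points below their own quantile, and then over the level,
weighs it with the probability that the random variable exceeds the point. -/
lemma integral_integral_le_quantile {ν : ℝ → Measure α} {W : α → ℝ} (hW : Measurable W)
    {S : Set ℝ} (hS : MeasurableSet S) (hν : ∀ y ∈ S, IsProbabilityMeasure (ν y))
    (hmeas : ∀ q : ℝ, Measurable fun y => (ν y).real {x | W x ≤ q}) {f : ℝ → ℝ}
    (hf : IntegrableOn f S) :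
    IntegrableOn (fun τ => ∫ y in S ∩ {y | y ≤ quantile (ν y) W τ}, f y) (Ioo 0 1) ∧
    ∫ τ in Ioo (0 : ℝ) 1, ∫ y in S ∩ {y | y ≤ quantile (ν y) W τ}, f y =
      ∫ y in S, f y * (ν y).real {x | y ≤ W x} := by
  -- a measurable version of the set of pairs with `quantile (ν y) W τ < y`
  set D : Set (ℝ × ℝ) := ⋃ q : ℚ, {p | (q : ℝ) < p.2 ∧ p.1 ≤ (ν p.2).real {x | W x ≤ (q : ℝ)}}
    with hD
  have hDm : MeasurableSet D := MeasurableSet.iUnion fun q =>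
    (measurableSet_lt measurable_const measurable_snd).inter
      (measurableSet_le measurable_fst ((hmeas q).comp measurable_snd))
  have hmem : ∀ τ ∈ Ioo (0 : ℝ) 1, ∀ y ∈ S, ((τ, y) ∈ Dᶜ ↔ y ≤ quantile (ν y) W τ) := by
    intro τ hτ y hy
    have := hν y hy
    rw [← not_lt, mem_compl_iff, not_iff_not, hD, mem_iUnion]
    constructor
    · rintro ⟨q, hq, hτq⟩
      exact ((quantile_le_iff (ν y) hW hτ _).2 hτq).trans_lt hq
    · intro hlt
      obtain ⟨q, hq1, hq2⟩ := exists_rat_btwn hlt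
      exact ⟨q, hq2, (quantile_le_iff (ν y) hW hτ _).1 hq1.le⟩
  have hint : Integrable (Function.uncurry fun τ y => Dᶜ.indicator (fun p : ℝ × ℝ => f p.2) (τ, y))
      ((volume.restrict (Ioo (0 : ℝ) 1)).prod (volume.restrict S)) :=
    (Integrable.comp_snd hf (volume.restrict (Ioo (0 : ℝ) 1))).indicator hDm.compl
  have hinner : ∀ τ ∈ Ioo (0 : ℝ) 1, ∫ y in S ∩ {y | y ≤ quantile (ν y) W τ}, f y =
      ∫ y in S, Dᶜ.indicator (fun p : ℝ × ℝ => f p.2) (τ, y) := by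
    intro τ hτ
    have hset : S ∩ {y | y ≤ quantile (ν y) W τ} = S ∩ (fun y => (τ, y)) ⁻¹' Dᶜ := by
      ext y
      exact and_congr_right fun hy => (hmem τ hτ y hy).symm
    rw [hset, ← setIntegral_indicator (measurable_prodMk_left hDm.compl)]
    rfl
  constructor
  · refine (hint.integral_prod_left).congr ?_
    filter_upwards [ae_restrict_mem measurableSet_Ioo] with τ hτ
    exact (hinner τ hτ).symm
  rw [setIntegral_congr_fun measurableSet_Ioo hinner, integral_integral_swap hint]
  refine setIntegral_congr_fun hS fun y hy => ?_
  have := hν y hy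
  have hrw : ∀ τ, Dᶜ.indicator (fun p : ℝ × ℝ => f p.2) (τ, y) =
      ((fun τ => (τ, y)) ⁻¹' Dᶜ).indicator (fun _ => f y) τ := fun τ => rfl
  simp only [hrw]
  rw [integral_indicator_const _ (measurable_prodMk_right hDm.compl), smul_eq_mul, mul_comm]
  congr 1
  have h1 : (ν y).real {x | y ≤ W x} = ((ν y).map W).real (Ici y) := by
    rw [map_measureReal_apply hW measurableSet_Ici]
    rfl
  rw [h1, ← map_quantile (ν y) hW, measureReal_def, measureReal_def,
    Measure.map_apply_of_aemeasurable (aemeasurable_quantile _ hW) measurableSet_Ici,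
    Measure.restrict_apply' measurableSet_Ioo, Measure.restrict_apply' measurableSet_Ioo]
  congr 2
  ext τ
  exact and_congr_left fun hτ => hmem τ hτ y hy

end Quantile

/-! ### Weighted measures -/

section Weighted

variable {α : Type*} [MeasurableSpace α]

lemma integral_weighted (μ : Measure α) {w : α → ℝ} (hw : Measurable w) (hw0 : ∀ x, 0 ≤ w x)
    (φ : α → ℝ) : ∫ x, φ x ∂(weighted μ w) = (∫ x, w x ∂μ)⁻¹ * ∫ x, w x * φ x ∂μ := by
  rw [weighted, integral_smul_measure, integral_withDensity_eq_integral_toReal_smul hw.ennreal_ofReal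
    (Filter.Eventually.of_forall fun _ => ENNReal.ofReal_lt_top), ENNReal.toReal_inv,
    ENNReal.toReal_ofReal (integral_nonneg hw0), smul_eq_mul]
  congr 2
  funext x
  rw [ENNReal.toReal_ofReal (hw0 x), smul_eq_mul]

lemma isProbabilityMeasure_weighted {μ : Measure α} {w : α → ℝ} (hw0 : ∀ x, 0 ≤ w x)
    (hint : Integrable w μ) (hpos : 0 < ∫ x, w x ∂μ) : IsProbabilityMeasure (weighted μ w) := by
  constructor
  rw [weighted, Measure.smul_apply, withDensity_apply _ MeasurableSet.univ, Measure.restrict_univ,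
    ← ofReal_integral_eq_lintegral_ofReal hint (Filter.Eventually.of_forall hw0), smul_eq_mul]
  exact ENNReal.inv_mul_cancel (ENNReal.ofReal_pos.2 hpos).ne' ENNReal.ofReal_ne_top

lemma measureReal_weighted (μ : Measure α) {w : α → ℝ} (hw : Measurable w) (hw0 : ∀ x, 0 ≤ w x)
    {A : Set α} (hA : MeasurableSet A) :
    (weighted μ w).real A = (∫ x, w x ∂μ)⁻¹ * ∫ x in A, w x ∂μ := by
  have h := integral_weighted μ hw hw0 (A.indicator 1)
  rw [integral_indicator_one hA] at h
  rw [h, ← integral_indicator hA]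
  congr 2
  funext x
  by_cases hx : x ∈ A <;> simp [hx]

lemma setIntegral_eq_zero_of_weighted_eq_zero {μ : Measure α} {w : α → ℝ} {A : Set α}
    (hA : MeasurableSet A) (hw : Measurable w) (hw0 : ∀ x, 0 ≤ w x) (h : weighted μ w A = 0) :
    ∫ x in A, w x ∂μ = 0 := by
  rw [weighted, Measure.smul_apply, smul_eq_mul, mul_eq_zero] at h
  have h' := h.resolve_left (ENNReal.inv_ne_zero.2 ENNReal.ofReal_ne_top)
  rw [withDensity_apply _ hA] at h'
  rw [integral_eq_lintegral_of_nonneg_ae (Filter.Eventually.of_forall hw0) hw.aestronglyMeasurable,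
    h', ENNReal.toReal_zero]

end Weighted

/-! ### Lagrange inversion averaged over quantile levels -/

namespace LagrangeInversion

open Filter Topology

variable {a b ρ δ : ℝ} {f : ℝ → ℝ} {g : ℝ → ℝ → ℝ} {F : ℂ → ℂ} {G : ℝ → ℂ → ℂ}

/-- The function `f` times the average of `(g τ - a) ^ j` over the level `τ ∈ (0, 1)`. -/
noncomputable def averagedMoment (a : ℝ) (f : ℝ → ℝ) (g : ℝ → ℝ → ℝ) (j : ℕ) (y : ℝ) : ℝ :=
  f y * ∫ τ in Ioo (0 : ℝ) 1, (g τ y - a) ^ j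

/-- The `(j + 1)`-st summand of the averaged Lagrange series at `a`, the summands being counted
from one. -/
noncomputable def averagedTerm (a b : ℝ) (f : ℝ → ℝ) (g : ℝ → ℝ → ℝ) (j : ℕ) : ℝ :=
  (1 / ((j + 1).factorial : ℝ)) *
    iteratedDerivWithin j (averagedMoment a f g (j + 1)) (Icc a b) a

/-- The integral of `f` over the points `y` with `y ≤ g τ y`. -/
noncomputable def massBelow (a b : ℝ) (f : ℝ → ℝ) (g : ℝ → ℝ → ℝ) (τ : ℝ) : ℝ :=
  ∫ y in Icc a b ∩ {y | y ≤ g τ y}, f y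

/-- Analytic functions `f` and `g τ` to which Lagrange inversion applies for each level `τ`, with
constants that do not depend on the level. -/
structure LagrangeFamily (a b ρ δ : ℝ) (f : ℝ → ℝ) (g : ℝ → ℝ → ℝ) (F : ℂ → ℂ)
    (G : ℝ → ℂ → ℂ) : Prop where
  ρ_pos : 0 < ρ
  lt : a < b
  δ_mem : δ ∈ Ico (0 : ℝ) 1
  continuation : IsAnalyticContinuation a b ρ f F
  continuation_level : ∀ τ ∈ Ioo (0 : ℝ) 1, IsAnalyticContinuation a b ρ (g τ) (G τ)
  left_le : ∀ τ ∈ Ioo (0 : ℝ) 1, a ≤ g τ a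
  le_right : ∀ τ ∈ Ioo (0 : ℝ) 1, g τ b ≤ b
  contraction : ∀ τ ∈ Ioo (0 : ℝ) 1, ∀ y ∈ Icc a b, y ≤ g τ y →
    ∀ z ∈ Metric.sphere (y : ℂ) ρ, ‖G τ z - y‖ ≤ δ * ρ
  bounded : ∃ C : ℝ, ∀ τ ∈ Ioo (0 : ℝ) 1, ∀ y ∈ Icc a b,
    ∀ z ∈ Metric.sphere (y : ℂ) ρ, ‖G τ z‖ ≤ C
  aemeasurable : ∀ y ∈ Icc a b, AEMeasurable (fun τ => g τ y) (volume.restrict (Ioo 0 1))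
  integrableOn_mass : IntegrableOn (massBelow a b f g) (Ioo 0 1)

namespace LagrangeFamily

lemma differentiableOn_kernel (h : LagrangeFamily a b ρ δ f g F G) (j : ℕ) :
    ∀ᵐ τ ∂(volume.restrict (Ioo (0 : ℝ) 1)), ∀ y ∈ Icc a b,
      DifferentiableOn ℂ (fun z => (G τ z - a) ^ j * F z) (Metric.closedBall (y : ℂ) ρ) := by
  filter_upwards [ae_restrict_mem measurableSet_Ioo] with τ hτ y hy
  exact (((h.continuation_level τ hτ).differentiableOn_closedBall hy).sub_const _).pow j
    |>.mul (h.continuation.differentiableOn_closedBall hy)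

lemma bounded_kernel (h : LagrangeFamily a b ρ δ f g F G) (j : ℕ) :
    ∃ C : ℝ, ∀ᵐ τ ∂(volume.restrict (Ioo (0 : ℝ) 1)), ∀ y ∈ Icc a b,
      ∀ z ∈ Metric.sphere (y : ℂ) ρ, ‖(G τ z - a) ^ j * F z‖ ≤ C := by
  obtain ⟨CG, hCG⟩ := h.bounded
  obtain ⟨CF, hCF0, hCF⟩ := h.continuation.exists_bound h.ρ_pos
  refine ⟨(CG + ‖(a : ℂ)‖) ^ j * CF, ?_⟩
  filter_upwards [ae_restrict_mem measurableSet_Ioo] with τ hτ y hy z hz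
  rw [norm_mul, norm_pow]
  have h1 := (norm_sub_le (G τ z) (a : ℂ)).trans (add_le_add_left (hCG τ hτ y hy z hz) _)
  have h2 := hCF y hy z hz
  have h3 : 0 ≤ CG + ‖(a : ℂ)‖ := (norm_nonneg _).trans h1
  gcongr

lemma aestronglyMeasurable_kernel (h : LagrangeFamily a b ρ δ f g F G) (j : ℕ) :
    ∀ y ∈ Icc a b, AEStronglyMeasurable (fun τ => (G τ (y : ℂ) - a) ^ j * F y)
      (volume.restrict (Ioo (0 : ℝ) 1)) := by
  intro y hy
  have h1 : AEMeasurable (fun τ => (((g τ y - a) ^ j * f y : ℝ) : ℂ))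
      (volume.restrict (Ioo (0 : ℝ) 1)) :=
    Complex.measurable_ofReal.comp_aemeasurable
      ((((h.aemeasurable y hy).sub_const a).pow_const j).mul_const (f y))
  refine h1.aestronglyMeasurable.congr ?_
  filter_upwards [ae_restrict_mem measurableSet_Ioo] with τ hτ
  rw [(h.continuation_level τ hτ).2 y hy, h.continuation.2 y hy]
  push_cast
  rfl

lemma averagedMoment_eq (h : LagrangeFamily a b ρ δ f g F G) (j : ℕ) {y : ℝ} (hy : y ∈ Icc a b) :
    averagedMoment a f g j y =
      (∫ τ in Ioo (0 : ℝ) 1, (G τ (y : ℂ) - a) ^ j * F y).re := by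
  have hcongr : ∫ τ in Ioo (0 : ℝ) 1, (G τ (y : ℂ) - a) ^ j * F y =
      ∫ τ in Ioo (0 : ℝ) 1, (((g τ y - a) ^ j * f y : ℝ) : ℂ) :=
    setIntegral_congr_fun measurableSet_Ioo fun τ hτ => by
      rw [(h.continuation_level τ hτ).2 y hy, h.continuation.2 y hy]
      push_cast
      rfl
  rw [hcongr, integral_complex_ofReal, Complex.ofReal_re, integral_mul_const, averagedMoment,
    mul_comm]

lemma contDiffOn_averagedMoment (h : LagrangeFamily a b ρ δ f g F G) (j : ℕ) :
    ContDiffOn ℝ (⊤ : ℕ∞) (averagedMoment a f g j) (Icc a b) := by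
  obtain ⟨C, hC⟩ := h.bounded_kernel j
  exact (AnalyticAverage.contDiffOn_and_iteratedDerivWithin h.ρ_pos h.lt
    (h.differentiableOn_kernel j) hC (h.aestronglyMeasurable_kernel j)
    fun y hy => h.averagedMoment_eq j hy).1

lemma integrableOn_movingDeriv (h : LagrangeFamily a b ρ δ f g F G) (j : ℕ) :
    IntegrableOn (fun τ => (1 / ((j + 1).factorial : ℂ)) * movingDeriv (G τ) F j (j + 1) a)
      (Ioo 0 1) := by
  obtain ⟨C, hC⟩ := h.bounded_kernel (j + 1)
  exact (AnalyticAverage.integrable_iteratedDeriv h.ρ_pos h.lt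
    (h.differentiableOn_kernel (j + 1)) hC (h.aestronglyMeasurable_kernel (j + 1)) j
    (left_mem_Icc.2 h.lt.le)).const_mul _

lemma averagedTerm_eq (h : LagrangeFamily a b ρ δ f g F G) (j : ℕ) :
    averagedTerm a b f g j = (∫ τ in Ioo (0 : ℝ) 1,
      (1 / ((j + 1).factorial : ℂ)) * movingDeriv (G τ) F j (j + 1) a).re := by
  obtain ⟨C, hC⟩ := h.bounded_kernel (j + 1)
  have hder := (AnalyticAverage.contDiffOn_and_iteratedDerivWithin h.ρ_pos h.lt
    (h.differentiableOn_kernel (j + 1)) hC (h.aestronglyMeasurable_kernel (j + 1))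
    fun y hy => h.averagedMoment_eq (j + 1) hy).2 j a (left_mem_Icc.2 h.lt.le)
  have hcast : (1 / ((j + 1).factorial : ℂ)) = ((1 / ((j + 1).factorial : ℝ) : ℝ) : ℂ) := by
    push_cast
    rfl
  rw [averagedTerm, hder, integral_const_mul, hcast, Complex.re_ofReal_mul]
  rfl

lemma sum_averagedTerm_eq (h : LagrangeFamily a b ρ δ f g F G) (l : ℕ) :
    ∑ j ∈ Finset.range l, averagedTerm a b f g j =
      (∫ τ in Ioo (0 : ℝ) 1, partialSum (G τ) F l a).re := by
  simp only [partialSum]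
  rw [integral_finsetSum _ fun j _ => h.integrableOn_movingDeriv j, Complex.re_sum]
  exact Finset.sum_congr rfl fun j _ => h.averagedTerm_eq j

/-- The remainder of the averaged Lagrange series, for an arbitrary bound `Φ` on the circle means
of `F`. -/
lemma abs_integral_sub_sum_le (h : LagrangeFamily a b ρ δ f g F G) {Φ : ℝ → ℝ}
    (hΦ : ContinuousOn Φ (Icc a b))
    (hFΦ : ∀ y ∈ Icc a b, ∫ x in (0 : ℝ)..1, ‖F (circlePoint y ρ x)‖ ≤ Φ y)
    {M : ℝ → ℝ} (hM : IntegrableOn M (Ioo 0 1))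
    (hΦM : ∀ τ ∈ Ioo (0 : ℝ) 1, ∫ y in Icc a b ∩ {y | y ≤ g τ y}, Φ y ≤ M τ) (l : ℕ) :
    |(∫ τ in Ioo (0 : ℝ) 1, massBelow a b f g τ) - ∑ j ∈ Finset.range l, averagedTerm a b f g j| ≤
      δ ^ l * ∫ τ in Ioo (0 : ℝ) 1, M τ := by
  have hA : Integrable (fun τ => ((massBelow a b f g τ : ℝ) : ℂ)) (volume.restrict (Ioo 0 1)) :=
    h.integrableOn_mass.ofReal
  have hP : Integrable (fun τ => partialSum (G τ) F l a) (volume.restrict (Ioo 0 1)) :=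
    integrable_finsetSum _ fun j _ => h.integrableOn_movingDeriv j
  have hre : (∫ τ in Ioo (0 : ℝ) 1, massBelow a b f g τ) -
      ∑ j ∈ Finset.range l, averagedTerm a b f g j =
      (∫ τ in Ioo (0 : ℝ) 1, (((massBelow a b f g τ : ℝ) : ℂ) - partialSum (G τ) F l a)).re := by
    rw [integral_sub hA hP, Complex.sub_re, integral_complex_ofReal, Complex.ofReal_re,
      h.sum_averagedTerm_eq]
  rw [hre, ← integral_const_mul]
  refine (Complex.abs_re_le_norm _).trans (norm_integral_le_of_norm_le (hM.const_mul _) ?_)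
  filter_upwards [ae_restrict_mem measurableSet_Ioo] with τ hτ
  exact (norm_integral_sub_partialSum_le h.ρ_pos h.lt.le h.δ_mem h.continuation
    (h.continuation_level τ hτ) (h.left_le τ hτ) (h.le_right τ hτ) (h.contraction τ hτ) hΦ hFΦ
    l).trans (mul_le_mul_of_nonneg_left (hΦM τ hτ) (pow_nonneg h.δ_mem.1 l))

lemma summable_averagedTerm_and_tsum (h : LagrangeFamily a b ρ δ f g F G) :
    Summable (averagedTerm a b f g) ∧
      ∑' j, averagedTerm a b f g j = ∫ τ in Ioo (0 : ℝ) 1, massBelow a b f g τ := by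
  obtain ⟨C, hC0, hC⟩ := h.continuation.exists_bound h.ρ_pos
  set I := ∫ τ in Ioo (0 : ℝ) 1, massBelow a b f g τ
  set D := ∫ _ in Ioo (0 : ℝ) 1, (b - a) * C with hD
  have hmean : ∀ y ∈ Icc a b, ∫ x in (0 : ℝ)..1, ‖F (circlePoint y ρ x)‖ ≤ C := by
    intro y hy
    have := intervalIntegral.norm_integral_le_of_norm_le_const (a := (0 : ℝ)) (b := 1) (C := C)
      (f := fun x => ‖F (circlePoint y ρ x)‖) fun x _ => by
        rw [norm_norm]; exact hC y hy _ (circlePoint_mem_sphere h.ρ_pos x)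
    simpa using (le_abs_self _).trans this
  have hrem : ∀ l, |I - ∑ j ∈ Finset.range l, averagedTerm a b f g j| ≤ δ ^ l * D := by
    intro l
    refine h.abs_integral_sub_sum_le continuousOn_const hmean (integrable_const _) (fun τ _ => ?_) l
    calc ∫ y in Icc a b ∩ {y | y ≤ g τ y}, C ≤ ∫ y in Icc a b, C :=
          setIntegral_mono_set (integrable_const _) (Eventually.of_forall fun _ => hC0)
            (inter_subset_left.eventuallyLE)
      _ = (b - a) * C := by
        simp [Measure.real, Real.volume_Icc, ENNReal.toReal_ofReal (sub_nonneg.2 h.lt.le)]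
  have hsum : Summable (averagedTerm a b f g) := by
    refine Summable.of_norm_bounded (g := fun l => 2 * D * δ ^ l)
      ((summable_geometric_of_lt_one h.δ_mem.1 h.δ_mem.2).mul_left _) fun l => ?_
    have h1 := abs_le.1 (hrem l)
    have h2 := abs_le.1 (hrem (l + 1))
    rw [Finset.sum_range_succ] at h2
    have hD0 : 0 ≤ D := by simpa using (abs_nonneg _).trans (hrem 0)
    have h3 : δ ^ (l + 1) * D ≤ δ ^ l * D := by
      rw [pow_succ]
      have := mul_nonneg (pow_nonneg h.δ_mem.1 l) hD0
      nlinarith [h.δ_mem.2]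
    rw [Real.norm_eq_abs, abs_le]
    constructor <;> linarith [h1.1, h1.2, h2.1, h2.2]
  refine ⟨hsum, ?_⟩
  refine tendsto_nhds_unique hsum.hasSum.tendsto_sum_nat ?_
  have h0 : Tendsto (fun l => δ ^ l * D) atTop (𝓝 0) := by
    simpa using (tendsto_pow_atTop_nhds_zero_of_lt_one h.δ_mem.1 h.δ_mem.2).mul_const D
  have h1 := squeeze_zero_norm (fun l => (Real.norm_eq_abs _).trans_le (hrem l)) h0
  simpa using h1.const_sub I

lemma abs_tsum_averagedTerm_add_le (h : LagrangeFamily a b ρ δ f g F G) {β : ℝ}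
    (hβ : ∀ y ∈ Icc a b, ∫ x in (0 : ℝ)..1, ‖F (circlePoint y ρ x)‖ ≤ β * f y) (l : ℕ) :
    |∑' j, averagedTerm a b f g (j + l)| ≤ β * δ ^ l * ∑' j, averagedTerm a b f g j := by
  obtain ⟨hsum, htsum⟩ := h.summable_averagedTerm_and_tsum
  have hsplit := hsum.sum_add_tsum_nat_add l
  have hrem := h.abs_integral_sub_sum_le
    (continuousOn_const.mul (h.continuation.continuousOn h.ρ_pos)) hβ
    (h.integrableOn_mass.const_mul β) (fun τ _ => (integral_const_mul β f).le) l
  rw [← htsum, integral_const_mul, ← htsum] at hrem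
  have : ∑' j, averagedTerm a b f g (j + l) =
      ∑' j, averagedTerm a b f g j - ∑ j ∈ Finset.range l, averagedTerm a b f g j := by
    linarith
  rw [this]
  exact hrem.trans_eq (by ring)

end LagrangeFamily

end LagrangeInversion

/-! ### Choice under a kinked payoff -/

namespace KinkedChoice

open Filter Topology

/-- Two strictly concave payoffs on `[p, q]` that cross at `k`, together with their maximizers and
a maximizer `s` of the compound payoff, which follows `u₀` up to `k` and `u₁` beyond. -/
structure Kink (p q k : ℝ) (u₀ u₁ : ℝ → ℝ) (m₀ m₁ s : ℝ) : Prop where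
  concave₀ : StrictConcaveOn ℝ (Icc p q) u₀
  concave₁ : StrictConcaveOn ℝ (Icc p q) u₁
  below : ∀ y ∈ Icc p q, y ≤ k → u₀ y ≤ u₁ y
  above : ∀ y ∈ Icc p q, k ≤ y → u₁ y ≤ u₀ y
  mem₀ : m₀ ∈ Icc p q
  max₀ : IsMaxOn u₀ (Icc p q) m₀
  mem₁ : m₁ ∈ Icc p q
  max₁ : IsMaxOn u₁ (Icc p q) m₁
  mem : s ∈ Icc p q
  max : IsMaxOn (fun y => if y ≤ k then u₀ y else u₁ y) (Icc p q) s

variable {p q k m₀ m₁ s c : ℝ} {u₀ u₁ : ℝ → ℝ}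

namespace Kink

/-- The compound payoff is the minimum of the two payoffs, hence strictly concave. -/
lemma max_inf (h : Kink p q k u₀ u₁ m₀ m₁ s) : IsMaxOn (u₀ ⊓ u₁) (Icc p q) s := by
  have heq : ∀ y ∈ Icc p q, (u₀ ⊓ u₁) y = if y ≤ k then u₀ y else u₁ y := by
    intro y hy
    split_ifs with hyk
    · exact min_eq_left (h.below y hy hyk)
    · exact min_eq_right (h.above y hy (not_le.1 hyk).le)
  rw [isMaxOn_iff]
  intro y hy
  rw [heq y hy, heq s h.mem]
  exact isMaxOn_iff.1 h.max y hy

lemma choice_lt_iff (h : Kink p q k u₀ u₁ m₀ m₁ s) (hc : c ≤ k) : s < c ↔ m₀ < c := by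
  constructor
  · intro hs
    have hloc : IsLocalMaxOn u₀ (Icc p q) s := by
      filter_upwards [self_mem_nhdsWithin,
        mem_nhdsWithin_of_mem_nhds (Iio_mem_nhds (hs.trans_le hc))] with y hy hyk
      have := isMaxOn_iff.1 h.max y hy
      rwa [if_pos (le_of_lt hyk), if_pos (hs.trans_le hc).le] at this
    have hmax := IsMaxOn.of_isLocalMaxOn_of_concaveOn h.mem hloc h.concave₀.concaveOn
    rwa [← h.concave₀.eq_of_isMaxOn hmax h.max₀ h.mem h.mem₀]
  · intro hm
    have hmax : IsMaxOn (u₀ ⊓ u₁) (Icc p q) m₀ := isMaxOn_iff.2 fun y hy =>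
      calc (u₀ ⊓ u₁) y ≤ u₀ y := min_le_left _ _
        _ ≤ u₀ m₀ := isMaxOn_iff.1 h.max₀ y hy
        _ = (u₀ ⊓ u₁) m₀ := (min_eq_left (h.below m₀ h.mem₀ (hm.le.trans hc))).symm
    rwa [(h.concave₀.inf h.concave₁).eq_of_isMaxOn h.max_inf hmax h.mem h.mem₀]

lemma lt_choice_iff (h : Kink p q k u₀ u₁ m₀ m₁ s) (hc : k ≤ c) : c < s ↔ c < m₁ := by
  constructor
  · intro hs
    have hloc : IsLocalMaxOn u₁ (Icc p q) s := by
      filter_upwards [self_mem_nhdsWithin,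
        mem_nhdsWithin_of_mem_nhds (Ioi_mem_nhds (hc.trans_lt hs))] with y hy hyk
      have := isMaxOn_iff.1 h.max y hy
      rwa [if_neg (not_le.2 hyk), if_neg (not_le.2 (hc.trans_lt hs))] at this
    have hmax := IsMaxOn.of_isLocalMaxOn_of_concaveOn h.mem hloc h.concave₁.concaveOn
    rwa [← h.concave₁.eq_of_isMaxOn hmax h.max₁ h.mem h.mem₁]
  · intro hm
    have hmax : IsMaxOn (u₀ ⊓ u₁) (Icc p q) m₁ := isMaxOn_iff.2 fun y hy =>
      calc (u₀ ⊓ u₁) y ≤ u₁ y := min_le_right _ _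
        _ ≤ u₁ m₁ := isMaxOn_iff.1 h.max₁ y hy
        _ = (u₀ ⊓ u₁) m₁ := (min_eq_right (h.above m₁ h.mem₁ (hc.trans hm.le))).symm
    rwa [(h.concave₀.inf h.concave₁).eq_of_isMaxOn h.max_inf hmax h.mem h.mem₁]

end Kink

/-- If the maximizer of `u₁` lies above the kink, so does the maximizer of `u₀`. -/
lemma kink_le_of_le (h₀ : StrictConcaveOn ℝ (Icc p q) u₀) (h₁ : ConcaveOn ℝ (Icc p q) u₁)
    (below : ∀ y ∈ Icc p q, y ≤ k → u₀ y ≤ u₁ y) (hk : k ∈ Icc p q) (heq : u₀ k = u₁ k)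
    (hm₀ : m₀ ∈ Icc p q) (hmax₀ : IsMaxOn u₀ (Icc p q) m₀)
    (hm₁ : m₁ ∈ Icc p q) (hmax₁ : IsMaxOn u₁ (Icc p q) m₁) (hkm : k ≤ m₁) : k ≤ m₀ := by
  by_contra! hlt
  have h1 : u₁ m₀ ≤ u₁ k := by
    have := h₁.ge_on_segment hm₀ hm₁ (z := k)
      (by rw [segment_eq_Icc (hlt.le.trans hkm)]; exact ⟨hlt.le, hkm⟩)
    rwa [min_eq_left (isMaxOn_iff.1 hmax₁ m₀ hm₀)] at this
  have h2 : IsMaxOn u₀ (Icc p q) k := isMaxOn_iff.2 fun y hy =>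
    calc u₀ y ≤ u₀ m₀ := isMaxOn_iff.1 hmax₀ y hy
      _ ≤ u₁ m₀ := below m₀ hm₀ hlt.le
      _ ≤ u₀ k := h1.trans_eq heq.symm
  exact hlt.ne (h₀.eq_of_isMaxOn hmax₀ h2 hm₀ hk)

end KinkedChoice

namespace BunchingModel

variable {Ω : Type*} {dx dθ : ℕ} {M : BunchingModel Ω dx dθ}

lemma payoff_le_of_le (h1 : M.KinkedPayoff) {θ : EuclideanSpace ℝ (Fin dθ)}
    (hθ : θ ∈ M.paramSet) (x : M.covSet) {η : ℝ} (hη : η ∈ M.hetSet) {y : ℝ}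
    (hy : y ∈ Icc M.yLow M.yUp) (hyk : y ≤ M.k) : M.U 0 y x η θ ≤ M.U 1 y x η θ := by
  obtain ⟨hlt, heq, -⟩ := h1.crossing θ hθ x η hη y hy
  rcases hyk.lt_or_eq with h | h
  · exact sub_nonpos.1 (hlt h)
  · exact sub_nonpos.1 (heq h).le

lemma payoff_ge_of_ge (h1 : M.KinkedPayoff) {θ : EuclideanSpace ℝ (Fin dθ)}
    (hθ : θ ∈ M.paramSet) (x : M.covSet) {η : ℝ} (hη : η ∈ M.hetSet) {y : ℝ}
    (hy : y ∈ Icc M.yLow M.yUp) (hyk : M.k ≤ y) : M.U 1 y x η θ ≤ M.U 0 y x η θ := by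
  obtain ⟨-, heq, hgt⟩ := h1.crossing θ hθ x η hη y hy
  rcases hyk.lt_or_eq with h | h
  · exact sub_nonneg.1 (hgt h)
  · exact sub_nonneg.1 (heq h.symm).ge

lemma mInv_k₁_mem (h2 : M.InvertibleStructure) {θ : EuclideanSpace ℝ (Fin dθ)}
    (hθ : θ ∈ M.paramSet) (x : M.covSet) : M.mInv 1 x M.k₁ θ ∈ M.hetSet :=
  Function.invFunOn_mem (h2.k₁_mem_range θ hθ x)

lemma m_mInv_k₁ (h2 : M.InvertibleStructure) {θ : EuclideanSpace ℝ (Fin dθ)}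
    (hθ : θ ∈ M.paramSet) (x : M.covSet) : M.m 1 x (M.mInv 1 x M.k₁ θ) θ = M.k₁ :=
  Function.invFunOn_eq (f := fun η => M.m 1 x η θ) (h2.k₁_mem_range θ hθ x)

lemma continuous_reversion (h2 : M.InvertibleStructure) {θ : EuclideanSpace ℝ (Fin dθ)}
    (hθ : θ ∈ M.paramSet) : Continuous fun x => M.reversion M.k₁ x θ := by
  have hinv : Continuous fun x : M.covSet => M.mInv 1 x M.k₁ θ :=
    (h2.continuous_mInv 1 θ hθ).comp_continuous (f := fun x : M.covSet => (x, M.k₁))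
      (by fun_prop) fun x => h2.k₁_mem_range θ hθ x
  exact (h2.continuous_m 0 θ hθ).comp_continuous
    (f := fun x : M.covSet => (x, M.mInv 1 x M.k₁ θ)) (by fun_prop) fun x => mInv_k₁_mem h2 hθ x

variable [MeasurableSpace Ω] {P : Measure Ω}

lemma measurable_choice (hE : M.Environment) (h2 : M.InvertibleStructure) (d : Fin 2) :
    Measurable (M.choice d) := by
  have hc := (h2.continuous_m d M.θ₀ hE.θ₀_mem).domRestrict
  have hm : Measurable fun ω => (⟨(M.X ω, M.η ω), hE.η_mem ω⟩ :
      {p : M.covSet × ℝ | p.2 ∈ M.hetSet}) :=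
    (hE.measurable_X.prodMk hE.measurable_η).subtype_mk
  exact hc.measurable.comp hm

/-- The reversion of `k₁` is at least the cutoff; in particular it is never below the window. -/
lemma k_le_reversion (hE : M.Environment) (h1 : M.KinkedPayoff) (h2 : M.InvertibleStructure)
    (h3 : M.WindowAndDensity P) {θ : EuclideanSpace ℝ (Fin dθ)} (hθ : θ ∈ M.paramSet)
    (x : M.covSet) : M.k ≤ M.reversion M.k₁ x θ := by
  set e := M.mInv 1 x M.k₁ θ
  have he : e ∈ M.hetSet := mInv_k₁_mem h2 hθ x
  have hk := Ioo_subset_Icc_self hE.k_mem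
  obtain ⟨hm₀, hmax₀⟩ := hE.choice_max θ hθ 0 x e he
  obtain ⟨hm₁, hmax₁⟩ := hE.choice_max θ hθ 1 x e he
  exact KinkedChoice.kink_le_of_le (h1.strictConcave θ hθ 0 x e he)
    (h1.strictConcave θ hθ 1 x e he).concaveOn (fun y hy => payoff_le_of_le h1 hθ x he hy) hk
    (sub_eq_zero.1 ((h1.crossing θ hθ x e he M.k hk).2.1 rfl)) hm₀ hmax₀ hm₁ hmax₁
    (by rw [m_mInv_k₁ h2 hθ x]; exact h3.k_mem_window.2)

/-- The observed choice falls into the window exactly for the units with `k₀ ≤ Y*(0)` and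
`Y*(1) ≤ k₁`, and the latter condition says `Y*(0) ≤ R(k₁, X, θ₀)`. -/
lemma ae_Y_mem_window_iff (hE : M.Environment) (h1 : M.KinkedPayoff) (h2 : M.InvertibleStructure)
    (h3 : M.WindowAndDensity P) :
    ∀ᵐ ω ∂P, M.Y ω ∈ Icc M.k₀ M.k₁ ↔
      M.k₀ ≤ M.choice 0 ω ∧ M.choice 0 ω ≤ M.reversion M.k₁ (M.X ω) M.θ₀ := by
  filter_upwards [h3.no_error_outside] with ω hω
  have hY : M.Y ω ∈ Icc M.k₀ M.k₁ ↔ M.Ystar ω ∈ Icc M.k₀ M.k₁ := by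
    constructor
    · intro h
      by_contra hn
      rw [hω (Or.inr hn)] at h
      exact hn h
    · intro h
      by_contra hn
      rw [hω (Or.inl hn)] at hn
      exact hn h
  have hθ := hE.θ₀_mem
  have hη := hE.η_mem ω
  have hkink : KinkedChoice.Kink M.yLow M.yUp M.k (fun y => M.U 0 y (M.X ω) (M.η ω) M.θ₀)
      (fun y => M.U 1 y (M.X ω) (M.η ω) M.θ₀) (M.choice 0 ω) (M.choice 1 ω) (M.Ystar ω) :=
    { concave₀ := h1.strictConcave _ hθ 0 _ _ hη
      concave₁ := h1.strictConcave _ hθ 1 _ _ hη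
      below := fun y hy => payoff_le_of_le h1 hθ _ hη hy
      above := fun y hy => payoff_ge_of_ge h1 hθ _ hη hy
      mem₀ := (hE.choice_max _ hθ 0 _ _ hη).1
      max₀ := (hE.choice_max _ hθ 0 _ _ hη).2
      mem₁ := (hE.choice_max _ hθ 1 _ _ hη).1
      max₁ := (hE.choice_max _ hθ 1 _ _ hη).2
      mem := (hE.Ystar_max ω).1
      max := (hE.Ystar_max ω).2 }
  have hlow : M.k₀ ≤ M.Ystar ω ↔ M.k₀ ≤ M.choice 0 ω :=
    not_lt.symm.trans ((not_congr (hkink.choice_lt_iff h3.k_mem_window.1)).trans not_lt)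
  have hup : M.Ystar ω ≤ M.k₁ ↔ M.choice 1 ω ≤ M.k₁ :=
    not_lt.symm.trans ((not_congr (hkink.lt_choice_iff h3.k_mem_window.2)).trans not_lt)
  have he := mInv_k₁_mem h2 hθ (M.X ω)
  have hrev : M.choice 1 ω ≤ M.k₁ ↔ M.choice 0 ω ≤ M.reversion M.k₁ (M.X ω) M.θ₀ := by
    conv_lhs => rw [← m_mInv_k₁ h2 hθ (M.X ω)]
    exact ((h2.strictMono 1 (M.X ω) _ hθ).le_iff_le hη he).trans
      ((h2.strictMono 0 (M.X ω) _ hθ).le_iff_le hη he).symm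
  rw [hY, mem_Icc, hlow, hup, hrev]

lemma measurableSet_bunching (hE : M.Environment) (h2 : M.InvertibleStructure)
    {θ : EuclideanSpace ℝ (Fin dθ)} (hθ : θ ∈ M.paramSet) :
    MeasurableSet {ω | M.k₀ ≤ M.choice 0 ω ∧ M.choice 0 ω ≤ M.reversion M.k₁ (M.X ω) θ} :=
  (measurableSet_le measurable_const (measurable_choice hE h2 0)).inter
    (measurableSet_le (measurable_choice hE h2 0)
      ((continuous_reversion h2 hθ).measurable.comp hE.measurable_X))

/-- The true parameter predicts the observed bunching moment. -/
lemma observedMoment_eq (hE : M.Environment) (h1 : M.KinkedPayoff) (h2 : M.InvertibleStructure)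
    (h3 : M.WindowAndDensity P) :
    ∫ ω in {ω | M.Y ω ∈ Icc M.k₀ M.k₁}, M.T ω ∂P = M.predictedMoment P M.θ₀ :=
  setIntegral_congr_set ((ae_Y_mem_window_iff hE h1 h2 h3).mono fun _ hω => propext hω)

end BunchingModel

/-! ### Disintegration given the counterfactual choice -/

namespace BunchingModel

open LagrangeInversion

variable {Ω : Type*} [MeasurableSpace Ω] {dx dθ : ℕ} {M : BunchingModel Ω dx dθ} {P : Measure Ω}
  {κ : Kernel ℝ M.covSet} {ρ β δ : ℝ}

lemma f_pos (h3 : M.WindowAndDensity P) {y : ℝ} (hy : y ∈ Icc (M.lo 0) (M.hi 0)) :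
    0 < M.f 0 y := by
  obtain ⟨c₁, c₂, hc, -, h⟩ := h3.density_bounds
  exact hc.trans_le (h 0 y hy).1

lemma setIntegral_map_choice (h3 : M.WindowAndDensity P) {S : Set ℝ} (hS : MeasurableSet S)
    (hsub : S ⊆ Icc (M.lo 0) (M.hi 0)) (φ : ℝ → ℝ) :
    ∫ y in S, φ y ∂(P.map (M.choice 0)) = ∫ y in S, M.f 0 y * φ y := by
  have h : (P.map (M.choice 0)).restrict S =
      (volume.restrict S).withDensity fun y => ENNReal.ofReal (M.f 0 y) := by
    rw [← Measure.restrict_restrict_of_subset hsub, h3.density 0, restrict_withDensity hS,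
      Measure.restrict_restrict_of_subset hsub]
  rw [h, integral_withDensity_eq_integral_toReal_smul (h3.measurable_f 0).ennreal_ofReal
    (Filter.Eventually.of_forall fun _ => ENNReal.ofReal_lt_top)]
  refine setIntegral_congr_fun hS fun y hy => ?_
  simp only [ENNReal.toReal_ofReal (f_pos h3 (hsub hy)).le, smul_eq_mul]

lemma integrable_t [IsMarkovKernel κ] (hE : M.Environment)
    (h4 : M.IdentificationRegularity P κ ρ β δ) (y : ℝ) : Integrable M.t (κ y) := by
  obtain ⟨c₁, c₂, -, -, hle, -⟩ := h4.t_bounds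
  refine Integrable.of_bound hE.measurable_t.aestronglyMeasurable c₂
    (Filter.Eventually.of_forall fun x => ?_)
  rw [Real.norm_eq_abs, abs_of_nonneg (h4.t_nonneg x)]
  exact hle x

lemma integrable_T [IsProbabilityMeasure P] (hE : M.Environment)
    (h4 : M.IdentificationRegularity P κ ρ β δ) : Integrable M.T P := by
  obtain ⟨c₁, c₂, -, -, hle, -⟩ := h4.t_bounds
  refine Integrable.of_bound (hE.measurable_t.comp hE.measurable_X).aestronglyMeasurable c₂
    (Filter.Eventually.of_forall fun ω => ?_)
  rw [Real.norm_eq_abs, T, abs_of_nonneg (h4.t_nonneg _)]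
  exact hle _

lemma integral_t_pos (h4 : M.IdentificationRegularity P κ ρ β δ) {y : ℝ}
    (hy : y ∈ Icc (M.lo 0) (M.hi 0)) : 0 < ∫ x, M.t x ∂(κ y) := by
  obtain ⟨c₁, c₂, hc, -, -, h⟩ := h4.t_bounds
  exact hc.trans_le (h y hy)

/-- The expectation of `T` on an event about `(Y*(0), X)`, computed by conditioning on `Y*(0)`. -/
lemma setIntegral_T [IsProbabilityMeasure P] [IsMarkovKernel κ] (hE : M.Environment)
    (hκ : M.IsCondLaw P κ) (h2 : M.InvertibleStructure)
    (h4 : M.IdentificationRegularity P κ ρ β δ) {A : Set (ℝ × M.covSet)} (hA : MeasurableSet A) :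
    ∫ ω in {ω | (M.choice 0 ω, M.X ω) ∈ A}, M.T ω ∂P =
      ∫ y, ∫ x in {x | (y, x) ∈ A}, M.t x ∂(κ y) ∂(P.map (M.choice 0)) := by
  have hm := measurable_choice hE h2 0
  have hpair : Measurable fun ω => (M.choice 0 ω, M.X ω) := hm.prodMk hE.measurable_X
  have : IsProbabilityMeasure (P.map (M.choice 0)) :=
    Measure.isProbabilityMeasure_map hm.aemeasurable
  have ht : Measurable fun p : ℝ × M.covSet => M.t p.2 := hE.measurable_t.comp measurable_snd
  have h := setIntegral_map (μ := P) (f := fun p : ℝ × M.covSet => M.t p.2) hA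
    ht.aestronglyMeasurable hpair.aemeasurable
  have hset : {ω | (M.choice 0 ω, M.X ω) ∈ A} = (fun ω => (M.choice 0 ω, M.X ω)) ⁻¹' A := rfl
  have hT : ∀ ω, M.T ω = M.t (M.X ω) := fun _ => rfl
  simp only [hset, hT]
  rw [← h, hκ, ← integral_indicator hA, Measure.integral_compProd]
  · refine integral_congr_ae (Filter.Eventually.of_forall fun y => ?_)
    simp only
    have hAy : MeasurableSet {x | (y, x) ∈ A} := measurable_prodMk_left hA
    rw [← integral_indicator hAy]
    rfl
  · obtain ⟨c₁, c₂, hc1, hc2, hle, -⟩ := h4.t_bounds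
    refine Integrable.of_bound (ht.indicator hA).aestronglyMeasurable c₂
      (Filter.Eventually.of_forall fun p => ?_)
    refine (norm_indicator_le_norm_self _ p).trans ?_
    rw [Real.norm_eq_abs, abs_of_nonneg (h4.t_nonneg _)]
    exact hle _

lemma setIntegral_T_of_mem [IsProbabilityMeasure P] [IsMarkovKernel κ] (hE : M.Environment)
    (hκ : M.IsCondLaw P κ) (h2 : M.InvertibleStructure) (h3 : M.WindowAndDensity P)
    (h4 : M.IdentificationRegularity P κ ρ β δ) {A : Set (ℝ × M.covSet)} (hA : MeasurableSet A)
    {S : Set ℝ} (hS : MeasurableSet S) (hsub : S ⊆ Icc (M.lo 0) (M.hi 0)) :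
    ∫ ω in {ω | M.choice 0 ω ∈ S ∧ (M.choice 0 ω, M.X ω) ∈ A}, M.T ω ∂P =
      ∫ y in S, M.f 0 y * ∫ x in {x | (y, x) ∈ A}, M.t x ∂(κ y) := by
  rw [← setIntegral_map_choice h3 hS hsub]
  have h := setIntegral_T hE hκ h2 h4 ((measurable_fst hS).inter hA)
  refine h.trans ?_
  rw [← integral_indicator hS]
  refine integral_congr_ae (Filter.Eventually.of_forall fun y => ?_)
  by_cases hy : y ∈ S
  · rw [indicator_of_mem hy]
    simp [hy]
  · rw [indicator_of_notMem hy]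
    simp [hy]

lemma integral_T_pos [IsProbabilityMeasure P] [IsMarkovKernel κ] (hE : M.Environment)
    (hκ : M.IsCondLaw P κ) (h2 : M.InvertibleStructure) (h3 : M.WindowAndDensity P)
    (h4 : M.IdentificationRegularity P κ ρ β δ) : 0 < ∫ ω, M.T ω ∂P := by
  obtain ⟨c₁, c₂, hc, -, hf⟩ := h3.density_bounds
  obtain ⟨t₁, t₂, ht, -, htle, hge⟩ := h4.t_bounds
  have hlt : M.lo 0 < M.hi 0 := h3.k₀_interior.1.trans h3.k₀_interior.2
  have h := setIntegral_T_of_mem hE hκ h2 h3 h4 MeasurableSet.univ measurableSet_Icc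
    (Subset.refl (Icc (M.lo 0) (M.hi 0)))
  have hm : Measurable fun y => ∫ x, M.t x ∂(κ y) :=
    (hE.measurable_t.stronglyMeasurable.integral_kernel (κ := κ)).measurable
  have hle : ∫ y in Icc (M.lo 0) (M.hi 0), c₁ * t₁ ≤
      ∫ y in Icc (M.lo 0) (M.hi 0), M.f 0 y * ∫ x, M.t x ∂(κ y) := by
    refine setIntegral_mono_on (integrable_const _) ?_ measurableSet_Icc fun y hy => ?_
    · refine Integrable.of_bound ((h3.measurable_f 0).mul hm).aestronglyMeasurable (c₂ * t₂) ?_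
      filter_upwards [ae_restrict_mem measurableSet_Icc] with y hy
      have h0 := integral_t_pos h4 hy
      have hI : ∫ x, M.t x ∂(κ y) ≤ t₂ := by
        have := integral_mono (integrable_t hE h4 y) (integrable_const t₂) htle
        simpa using this
      rw [Real.norm_eq_abs, abs_of_pos (mul_pos (f_pos h3 hy) h0)]
      exact mul_le_mul (hf 0 y hy).2 hI h0.le ((f_pos h3 hy).le.trans (hf 0 y hy).2)
    · exact mul_le_mul (hf 0 y hy).1 (hge y hy) ht.le (f_pos h3 hy).le
  have hpos : 0 < ∫ y in Icc (M.lo 0) (M.hi 0), c₁ * t₁ := by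
    rw [setIntegral_const, smul_eq_mul, Measure.real, Real.volume_Icc,
      ENNReal.toReal_ofReal (sub_pos.2 hlt).le]
    exact mul_pos (sub_pos.2 hlt) (mul_pos hc ht)
  simp only [mem_univ, and_true, ofPred_true, Measure.restrict_univ] at h
  calc 0 < _ := hpos
    _ ≤ _ := hle
    _ = _ := h.symm
    _ ≤ ∫ ω, M.T ω ∂P := setIntegral_le_integral (integrable_T hE h4)
        (Filter.Eventually.of_forall fun ω => h4.t_nonneg _)

/-! ### The model as a family of Lagrange problems -/

/-- Everything that is assumed about the model and the conditional law of the covariates. -/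
structure Design (M : BunchingModel Ω dx dθ) (P : Measure Ω) (κ : Kernel ℝ M.covSet)
    (ρ β δ : ℝ) : Prop where
  env : M.Environment
  condLaw : M.IsCondLaw P κ
  payoff : M.KinkedPayoff
  invertible : M.InvertibleStructure
  window : M.WindowAndDensity P
  regular : M.IdentificationRegularity P κ ρ β δ

namespace Design

variable {θ : EuclideanSpace ℝ (Fin dθ)}

lemma Icc_subset (D : M.Design P κ ρ β δ) (hθ : θ ∈ M.paramSet) :
    Icc M.k₀ (M.kBar θ) ⊆ Icc (M.lo 0) (M.hi 0) :=
  Icc_subset_Icc D.window.k₀_interior.1.le (D.regular.kBar_mem θ hθ).1.2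

lemma measurable_reversion (D : M.Design P κ ρ β δ) (hθ : θ ∈ M.paramSet) :
    Measurable fun x => M.reversion M.k₁ x θ :=
  (continuous_reversion D.invertible hθ).measurable

lemma setIntegral_T_kBar_lt (D : M.Design P κ ρ β δ) (hθ : θ ∈ M.paramSet) :
    ∫ ω in {ω | M.kBar θ < M.reversion M.k₁ (M.X ω) θ ∧
      M.k₀ ≤ M.choice 0 ω ∧ M.choice 0 ω ≤ M.reversion M.k₁ (M.X ω) θ}, M.T ω ∂P = 0 :=
  setIntegral_eq_zero_of_weighted_eq_zero
    ((measurableSet_lt measurable_const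
      ((D.measurable_reversion hθ).comp D.env.measurable_X)).inter
      (measurableSet_bunching D.env D.invertible hθ))
    (D.env.measurable_t.comp D.env.measurable_X) (fun _ => D.regular.t_nonneg _)
    (D.regular.kBar_bound θ hθ)

variable [IsMarkovKernel κ]

lemma isProbabilityMeasure_weighted (D : M.Design P κ ρ β δ) (hθ : θ ∈ M.paramSet) {y : ℝ}
    (hy : y ∈ Icc M.k₀ (M.kBar θ)) : IsProbabilityMeasure (weighted (κ y) M.t) :=
  _root_.isProbabilityMeasure_weighted D.regular.t_nonneg (integrable_t D.env D.regular y)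
    (integral_t_pos D.regular (D.Icc_subset hθ hy))

/-- The quantiles inherit the lower bound on the reversion. -/
lemma k_le_gT (D : M.Design P κ ρ β δ) (hθ : θ ∈ M.paramSet) {y τ : ℝ}
    (hy : y ∈ Icc M.k₀ (M.kBar θ)) (hτ : τ ∈ Ioo (0 : ℝ) 1) : M.k ≤ M.gT κ θ τ y := by
  have := D.isProbabilityMeasure_weighted hθ hy
  by_contra! hlt
  have h := (quantile_le_iff (weighted (κ y) M.t) (D.measurable_reversion hθ) hτ _).1
    (le_refl (M.gT κ θ τ y))
  have hempty : {x | M.reversion M.k₁ x θ ≤ M.gT κ θ τ y} = ∅ := by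
    ext x
    have := k_le_reversion D.env D.payoff D.invertible D.window hθ x
    simp only [mem_ofPred_eq, mem_empty_iff_false, iff_false, not_le]
    exact hlt.trans_le this
  rw [hempty, measureReal_empty] at h
  exact absurd hτ.1 (not_lt.2 h)

variable [IsProbabilityMeasure P]

lemma integral_T_pos (D : M.Design P κ ρ β δ) : 0 < ∫ ω, M.T ω ∂P :=
  BunchingModel.integral_T_pos D.env D.condLaw D.invertible D.window D.regular

lemma fT_pos (D : M.Design P κ ρ β δ) (hθ : θ ∈ M.paramSet) {y : ℝ}
    (hy : y ∈ Icc M.k₀ (M.kBar θ)) : 0 < M.fT P κ y :=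
  div_pos (mul_pos (f_pos D.window (D.Icc_subset hθ hy))
    (integral_t_pos D.regular (D.Icc_subset hθ hy))) D.integral_T_pos

/-- The conditional probability that the reversion exceeds `kBar θ` vanishes, first almost
everywhere on the window. -/
lemma ae_gT_le_kBar (D : M.Design P κ ρ β δ) (hθ : θ ∈ M.paramSet) :
    ∀ᵐ y ∂(volume.restrict (Icc M.k₀ (M.kBar θ))), ∀ τ ∈ Ioo (0 : ℝ) 1,
      M.gT κ θ τ y ≤ M.kBar θ := by
  have hR := D.measurable_reversion hθ
  have hsub := D.Icc_subset hθ
  set A : Set (ℝ × M.covSet) := {p | M.kBar θ < M.reversion M.k₁ p.2 θ} with hA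
  have hAm : MeasurableSet A := measurableSet_lt measurable_const (hR.comp measurable_snd)
  have h0 := D.setIntegral_T_kBar_lt hθ
  have hI := setIntegral_T_of_mem D.env D.condLaw D.invertible D.window D.regular hAm
    measurableSet_Icc hsub
  have hset0 : ∫ ω in {ω | M.choice 0 ω ∈ Icc M.k₀ (M.kBar θ) ∧ (M.choice 0 ω, M.X ω) ∈ A},
      M.T ω ∂P ≤ 0 := by
    rw [← h0]
    refine setIntegral_mono_set (integrable_T D.env D.regular).integrableOn
      (Filter.Eventually.of_forall fun _ => D.regular.t_nonneg _) ?_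
    refine LE.le.eventuallyLE ?_
    rintro ω ⟨⟨h1, h2⟩, h3⟩
    exact ⟨h3, h1, h2.trans (le_of_lt h3)⟩
  rw [hI] at hset0
  have hAm' : ∀ y, MeasurableSet {x | (y, x) ∈ A} := fun y => measurable_prodMk_left hAm
  have hnn : ∀ y, 0 ≤ ∫ x in {x | (y, x) ∈ A}, M.t x ∂(κ y) := fun y =>
    integral_nonneg D.regular.t_nonneg
  have hnn' : 0 ≤ᵐ[volume.restrict (Icc M.k₀ (M.kBar θ))]
      fun y => M.f 0 y * ∫ x in {x | (y, x) ∈ A}, M.t x ∂(κ y) := by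
    filter_upwards [ae_restrict_mem measurableSet_Icc] with y hy
    exact mul_nonneg (f_pos D.window (hsub hy)).le (hnn y)
  have hmeas : Measurable fun y => ∫ x in {x | (y, x) ∈ A}, M.t x ∂(κ y) := by
    have : ∀ y, ∫ x in {x | (y, x) ∈ A}, M.t x ∂(κ y) =
        ∫ x, {x | M.kBar θ < M.reversion M.k₁ x θ}.indicator M.t x ∂(κ y) := fun y =>
      (integral_indicator (hAm' y)).symm
    simp only [this]
    exact ((D.env.measurable_t.indicator (measurableSet_lt measurable_const hR)
      ).stronglyMeasurable.integral_kernel (κ := κ)).measurable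
  obtain ⟨c₁, c₂, hc, -, hf⟩ := D.window.density_bounds
  obtain ⟨t₁, t₂, ht, -, htle, -⟩ := D.regular.t_bounds
  have hint : IntegrableOn (fun y => M.f 0 y * ∫ x in {x | (y, x) ∈ A}, M.t x ∂(κ y))
      (Icc M.k₀ (M.kBar θ)) := by
    refine Integrable.of_bound ((D.window.measurable_f 0).mul hmeas).aestronglyMeasurable
      (c₂ * t₂) ?_
    filter_upwards [ae_restrict_mem measurableSet_Icc] with y hy
    have h1 : ∫ x in {x | (y, x) ∈ A}, M.t x ∂(κ y) ≤ t₂ := by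
      refine (setIntegral_le_integral (integrable_t D.env D.regular y)
        (Filter.Eventually.of_forall D.regular.t_nonneg)).trans ?_
      simpa using integral_mono (integrable_t D.env D.regular y) (integrable_const t₂) htle
    have hfp := f_pos D.window (hsub hy)
    rw [Real.norm_eq_abs, abs_of_nonneg (mul_nonneg hfp.le (hnn y))]
    exact mul_le_mul (hf 0 y (hsub hy)).2 h1 (hnn y) (hfp.le.trans (hf 0 y (hsub hy)).2)
  have hzero := (setIntegral_eq_zero_iff_of_nonneg_ae hnn' hint).1
    (le_antisymm hset0 (integral_nonneg_of_ae hnn'))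
  filter_upwards [hzero, ae_restrict_mem measurableSet_Icc] with y hy0 hy τ hτ
  have hprob := D.isProbabilityMeasure_weighted hθ hy
  have h1 : ∫ x in {x | (y, x) ∈ A}, M.t x ∂(κ y) = 0 :=
    (mul_eq_zero.1 hy0).resolve_left (f_pos D.window (hsub hy)).ne'
  have h2 : (weighted (κ y) M.t).real {x | (y, x) ∈ A} = 0 := by
    rw [measureReal_weighted _ D.env.measurable_t D.regular.t_nonneg (hAm' y), h1, mul_zero]
  refine (quantile_le_iff _ hR hτ _).2 ?_
  have hcompl : {x | M.reversion M.k₁ x θ ≤ M.kBar θ} = {x | (y, x) ∈ A}ᶜ := by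
    ext x
    simp [hA]
  rw [hcompl, probReal_compl_eq_one_sub (hAm' y), h2, sub_zero]
  exact hτ.2.le

/-- Continuity in the conditioning value extends the bound by `kBar θ` to all of the window. -/
lemma gT_le_kBar (D : M.Design P κ ρ β δ) (hθ : θ ∈ M.paramSet) {y τ : ℝ}
    (hy : y ∈ Icc M.k₀ (M.kBar θ)) (hτ : τ ∈ Ioo (0 : ℝ) 1) : M.gT κ θ τ y ≤ M.kBar θ := by
  obtain ⟨F, G, -, hG, -⟩ := D.regular.analyticity θ hθ
  have hc := (hG τ hτ).continuousOn D.regular.ρ_pos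
  have h := Measure.eqOn_Icc_of_ae_eq volume (D.regular.kBar_mem θ hθ).2.ne
    (f := fun y => max (M.gT κ θ τ y) (M.kBar θ)) (g := fun _ => M.kBar θ)
    (by filter_upwards [D.ae_gT_le_kBar hθ] with y hy; exact max_eq_right (hy τ hτ))
    (hc.sup continuousOn_const) continuousOn_const hy
  exact max_eq_right_iff.1 h

/-- `E[T]` times the average over the quantile level of the mass of `{y | y ≤ g τ y}` is the
predicted bunching moment. -/
lemma mass_eq (D : M.Design P κ ρ β δ) (hθ : θ ∈ M.paramSet) :
    IntegrableOn (massBelow M.k₀ (M.kBar θ) (M.fT P κ) (M.gT κ θ)) (Ioo 0 1) ∧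
    (∫ ω, M.T ω ∂P) * ∫ τ in Ioo (0 : ℝ) 1, massBelow M.k₀ (M.kBar θ) (M.fT P κ) (M.gT κ θ) τ =
      M.predictedMoment P θ := by
  have hR := D.measurable_reversion hθ
  have hsub := D.Icc_subset hθ
  have hE0 := D.integral_T_pos
  have hmR : ∀ q : ℝ, MeasurableSet {x | M.reversion M.k₁ x θ ≤ q} := fun q =>
    measurableSet_le hR measurable_const
  have hmeas : ∀ q : ℝ, Measurable fun y =>
      (weighted (κ y) M.t).real {x | M.reversion M.k₁ x θ ≤ q} := by
    intro q
    simp only [measureReal_weighted _ D.env.measurable_t D.regular.t_nonneg (hmR q),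
      ← integral_indicator (hmR q)]
    exact ((D.env.measurable_t.stronglyMeasurable.integral_kernel (κ := κ)).measurable.inv).mul
      ((D.env.measurable_t.indicator (hmR q)).stronglyMeasurable.integral_kernel
        (κ := κ)).measurable
  obtain ⟨F, G, hF, -⟩ := D.regular.analyticity θ hθ
  obtain ⟨h1, h2⟩ := integral_integral_le_quantile (ν := fun y => weighted (κ y) M.t) hR
    measurableSet_Icc (fun y hy => D.isProbabilityMeasure_weighted hθ hy) hmeas
    ((hF.continuousOn D.regular.ρ_pos).integrableOn_Icc)
  refine ⟨h1, ?_⟩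
  set A : Set (ℝ × M.covSet) := {p | p.1 ≤ M.reversion M.k₁ p.2 θ} with hA
  have hAm : MeasurableSet A := measurableSet_le measurable_fst (hR.comp measurable_snd)
  have hAm' : ∀ y, MeasurableSet {x | (y, x) ∈ A} := fun y => measurable_prodMk_left hAm
  have hI := setIntegral_T_of_mem D.env D.condLaw D.invertible D.window D.regular hAm
    measurableSet_Icc hsub
  have hm0 := measurable_choice D.env D.invertible 0
  have hsplit := integral_inter_add_sdiff (μ := P)
    (s := {ω | M.k₀ ≤ M.choice 0 ω ∧ M.choice 0 ω ≤ M.reversion M.k₁ (M.X ω) θ})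
    (measurableSet_le hm0 (measurable_const (a := M.kBar θ)))
    (integrable_T D.env D.regular).integrableOn
  -- units above `kBar θ` do not contribute
  have hdiff : ∫ ω in {ω | M.k₀ ≤ M.choice 0 ω ∧ M.choice 0 ω ≤ M.reversion M.k₁ (M.X ω) θ} \
      {ω | M.choice 0 ω ≤ M.kBar θ}, M.T ω ∂P = 0 := by
    refine le_antisymm ?_ (integral_nonneg fun _ => D.regular.t_nonneg _)
    rw [← D.setIntegral_T_kBar_lt hθ]
    refine setIntegral_mono_set (integrable_T D.env D.regular).integrableOn
      (Filter.Eventually.of_forall fun _ => D.regular.t_nonneg _) ?_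
    refine LE.le.eventuallyLE ?_
    rintro ω ⟨⟨h1, h2⟩, h3⟩
    exact ⟨(not_le.1 h3).trans_le h2, h1, h2⟩
  have hset : {ω | M.k₀ ≤ M.choice 0 ω ∧ M.choice 0 ω ≤ M.reversion M.k₁ (M.X ω) θ} ∩
      {ω | M.choice 0 ω ≤ M.kBar θ} =
      {ω | M.choice 0 ω ∈ Icc M.k₀ (M.kBar θ) ∧ (M.choice 0 ω, M.X ω) ∈ A} := by
    ext ω
    simp only [hA, mem_inter_iff, mem_ofPred_eq, mem_Icc]
    tauto
  rw [hset, hdiff, add_zero, hI] at hsplit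
  have hmass : ∀ τ, massBelow M.k₀ (M.kBar θ) (M.fT P κ) (M.gT κ θ) τ =
    ∫ y in Icc M.k₀ (M.kBar θ) ∩ {y | y ≤ quantile (weighted (κ y) M.t)
      (fun x => M.reversion M.k₁ x θ) τ}, M.fT P κ y := fun _ => rfl
  simp only [hmass]
  rw [h2, predictedMoment, ← hsplit, ← integral_const_mul]
  refine setIntegral_congr_fun measurableSet_Icc fun y hy => ?_
  have hp := integral_t_pos D.regular (hsub hy)
  have hw := measureReal_weighted (κ y) D.env.measurable_t D.regular.t_nonneg (hAm' y)
  have hAy : {x | (y, x) ∈ A} = {x | y ≤ M.reversion M.k₁ x θ} := rfl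
  rw [hAy] at hw
  simp only [hAy, hw, fT]
  field_simp

lemma momentDensity_eq (D : M.Design P κ ρ β δ) (hθ : θ ∈ M.paramSet) (j : ℕ) {y : ℝ}
    (hy : y ∈ Icc M.k₀ (M.kBar θ)) :
    M.momentDensity κ θ j y =
      (∫ ω, M.T ω ∂P) * averagedMoment M.k₀ (M.fT P κ) (M.gT κ θ) j y := by
  have hprob := D.isProbabilityMeasure_weighted hθ hy
  have hE0 := D.integral_T_pos
  have hp := integral_t_pos D.regular (D.Icc_subset hθ hy)
  have hq := integral_comp_quantile (weighted (κ y) M.t) (D.measurable_reversion hθ)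
    (φ := fun r => (r - M.k₀) ^ j) (by fun_prop)
  rw [integral_weighted _ D.env.measurable_t D.regular.t_nonneg] at hq
  simp only [averagedMoment, gT]
  rw [hq]
  simp only [momentDensity, fT]
  field_simp

/-- The analytic continuation `F` of the density is left free, so that the error bound can be applied
to the continuation whose circle means are bounded pointwise. -/
lemma lagrangeFamily (D : M.Design P κ ρ β δ) (hθ : θ ∈ M.paramSet) {F : ℂ → ℂ}
    (hF : IsAnalyticContinuation M.k₀ (M.kBar θ) ρ (M.fT P κ) F) :
    ∃ G, LagrangeFamily M.k₀ (M.kBar θ) ρ δ (M.fT P κ) (M.gT κ θ) F G := by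
  obtain ⟨-, G, -, hG, -, hcontr, C, hC⟩ := D.regular.analyticity θ hθ
  have hρ := D.regular.ρ_pos
  have hlt := (D.regular.kBar_mem θ hθ).2
  refine ⟨G, ?_⟩
  exact
    { ρ_pos := hρ
      lt := hlt
      δ_mem := D.regular.δ_mem
      continuation := hF
      continuation_level := hG
      left_le := fun τ hτ =>
        D.window.k_mem_window.1.trans (D.k_le_gT hθ (left_mem_Icc.2 hlt.le) hτ)
      le_right := fun τ hτ => D.gT_le_kBar hθ (right_mem_Icc.2 hlt.le) hτ
      contraction := fun τ hτ y hy hyg z hz => by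
        obtain ⟨x, hx, rfl⟩ := exists_circlePoint_eq hρ hz
        exact hcontr y hy τ hτ x hx (sub_nonneg.2 hyg)
      bounded := ⟨C, fun τ hτ y hy z hz => by
        obtain ⟨x, hx, rfl⟩ := exists_circlePoint_eq hρ hz
        exact hC y hy τ hτ x hx⟩
      aemeasurable := fun y hy => by
        have := D.isProbabilityMeasure_weighted hθ hy
        exact aemeasurable_quantile _ (D.measurable_reversion hθ)
      integrableOn_mass := (D.mass_eq hθ).1 }

lemma seriesTerm_eq (D : M.Design P κ ρ β δ) (hθ : θ ∈ M.paramSet) (j : ℕ) :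
    M.seriesTerm κ θ j = (∫ ω, M.T ω ∂P) *
      averagedTerm M.k₀ (M.kBar θ) (M.fT P κ) (M.gT κ θ) j := by
  have hlt := (D.regular.kBar_mem θ hθ).2
  rw [seriesTerm, AnalyticAverage.iteratedDerivWithin_Ici_left hlt,
    iteratedDerivWithin_congr (fun y hy => D.momentDensity_eq hθ (j + 1) hy)
      (left_mem_Icc.2 hlt.le), iteratedDerivWithin_const_mul_field, averagedTerm]
  ring

lemma B_eq_mul_tsum (D : M.Design P κ ρ β δ) (hθ : θ ∈ M.paramSet) :
    M.B κ θ = (∫ ω, M.T ω ∂P) *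
      ∑' j, averagedTerm M.k₀ (M.kBar θ) (M.fT P κ) (M.gT κ θ) j := by
  simp only [B, D.seriesTerm_eq hθ, tsum_mul_left]

/-- The series sums to the bunching moment predicted by `θ`. -/
lemma B_eq_predictedMoment (D : M.Design P κ ρ β δ) (hθ : θ ∈ M.paramSet) :
    M.B κ θ = M.predictedMoment P θ := by
  obtain ⟨F, -, hF, -⟩ := D.regular.analyticity θ hθ
  obtain ⟨G, hL⟩ := D.lagrangeFamily hθ hF
  rw [D.B_eq_mul_tsum hθ, hL.summable_averagedTerm_and_tsum.2, (D.mass_eq hθ).2]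

end Design

end BunchingModel

theorem theorem1 {Ω : Type*} [MeasurableSpace Ω] (P : Measure Ω) [IsProbabilityMeasure P]
    {dx dθ : ℕ} (M : BunchingModel Ω dx dθ) (κ : Kernel ℝ M.covSet) [IsMarkovKernel κ]
    (ρ β δ : ℝ) (hE : M.Environment) (hκ : M.IsCondLaw P κ) (h1 : M.KinkedPayoff)
    (h2 : M.InvertibleStructure) (h3 : M.WindowAndDensity P)
    (h4 : M.IdentificationRegularity P κ ρ β δ) :
    (∀ θ ∈ M.paramSet,
      (∀ j : ℕ, ContDiffOn ℝ (⊤ : ℕ∞) (M.momentDensity κ θ (j + 1)) (Icc M.k₀ (M.kBar θ))) ∧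
      Summable (M.seriesTerm κ θ) ∧ 0 ≤ M.B κ θ) ∧
    (∀ θ ∈ M.paramSet,
      M.B κ θ = (∫ ω in {ω | M.Y ω ∈ Icc M.k₀ M.k₁}, M.T ω ∂P) ↔ θ = M.θ₀) ∧
    (∀ θ ∈ M.paramSet, RelativeVariationLE M.k₀ (M.kBar θ) (M.fT P κ) ρ β →
      ∀ l : ℕ, |∑' j : ℕ, M.seriesTerm κ θ (j + l)| ≤ β * δ ^ l * M.B κ θ) := by
  have D : M.Design P κ ρ β δ := ⟨hE, hκ, h1, h2, h3, h4⟩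
  refine ⟨fun θ hθ => ?_, fun θ hθ => ?_, fun θ hθ hV l => ?_⟩
  · obtain ⟨F, -, hF, -⟩ := h4.analyticity θ hθ
    obtain ⟨G, hL⟩ := D.lagrangeFamily hθ hF
    refine ⟨fun j => ?_, ?_, ?_⟩
    · exact (contDiffOn_const.mul (hL.contDiffOn_averagedMoment (j + 1))).congr
        fun y hy => D.momentDensity_eq hθ (j + 1) hy
    · exact (hL.summable_averagedTerm_and_tsum.1.mul_left _).congr
        fun j => (D.seriesTerm_eq hθ j).symm
    · rw [D.B_eq_predictedMoment hθ]
      exact integral_nonneg fun _ => h4.t_nonneg _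
  · rw [D.B_eq_predictedMoment hθ, BunchingModel.observedMoment_eq hE h1 h2 h3]
    exact ⟨fun h => h4.one_to_one hθ hE.θ₀_mem h, fun h => by rw [h]⟩
  · obtain ⟨F, hF, hFβ⟩ := hV
    obtain ⟨G, hL⟩ := D.lagrangeFamily hθ hF
    have h := hL.abs_tsum_averagedTerm_add_le (β := β) (fun y hy => by
      have := hFβ y hy
      rwa [abs_of_pos (D.fT_pos hθ hy)] at this) l
    simp only [D.seriesTerm_eq hθ, tsum_mul_left, D.B_eq_mul_tsum hθ]
    rw [abs_mul, abs_of_pos D.integral_T_pos]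
    calc _ ≤ _ := mul_le_mul_of_nonneg_left h D.integral_T_pos.le
      _ = _ := by ring
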